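/- Fix $1<p<\infty$ and let $L_p=L_p[0,1]$ be the real $L_p$-space of Lebesgue measure; $[\,\cdot\,]$ denotes the closed linear span. **Notation.** For $n\ge 0$ let $\mathcal D^n$ be the set of dyadic intervals $[\frac{i-1}{2^n},\frac{i}{2^n})$, $1\le i\le 2^n$, and $\mathcal D_n=\bigcup_{k=0}^n\mathcal D^k$. Order dyadic intervals lexicographically: for $I\in\mathcal D^m$, $J\in\mathcal D^n$, $I<J$ iff $m<n$, or $m=n$ and $\min I<\min J$. Let $I^+,I^-$ be the left and right halves of $I$, $h_I=\chi_{I^+}-\chi_{I^-}$, and let $L_p^{n,0}$ be the space of mean-zero functions in the span of $(\chi_I)_{I\in\mathcal D^n}$. For $I=[a,b)\subseteq[0,1)$ let $T_I:L_p\to L_p$ be $(T_If)(t)=f(\frac{t-a}{b-a})$ for $t\in I$ and $(T_If)(t)=0$ otherwise. For every countable limit ordinal $\alpha$ fix linear operators $T^\alpha_\beta:L_p\to L_p$, $0\le\beta<\alpha$, that are distributional embeddings ($T^\alpha_\beta f$ has the same distribution as $f$) with independent ranges (for all $(f_\beta)_{\beta<\alpha}$ in $L_p$ the functions $(T^\alpha_\beta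 f_\beta)_{\beta<\alpha}$ are independent). **Spaces.** Let $R_0^p$ be the constants, $R_{\beta+1}^p=T_{[0,1/2)}(R_\beta^p)+T_{[1/2,1)}(R_\beta^p)$, and $R_\alpha^p=[T_\beta^\alpha(R_\beta^p):\beta<\alpha]$ for limit $\alpha$; put $R_\alpha^{p,0}=\{f\in R_\alpha^p:\mathbb E f=0\}$. **Trees.** Every ordinal is uniquely $\alpha=\beta+\kappa(\alpha)$ with $\beta$ zero or a limit and $\kappa(\alpha)\in\mathbb N\cup\{0\}$. Define sets $\mathcal T_\alpha$ of finite sequences of ordinals and dyadic intervals by $\mathcal T_0=\emptyset$; $\mathcal T_\alpha=\{(\alpha)\}\cup\{(\alpha,I)^\frown\mu: I\in\mathcal D^{\kappa(\alpha)},\,\mu\in\mathcal T_\beta\}$ if $\alpha=\beta+\kappa(\alpha)$ is a successor; $\mathcal T_\alpha=\bigcup_{1\le\beta<\alpha}\{(\alpha)^\frown\mu:\mu\in\mathcal T_\beta\}$ if $\alpha$ is a limit. Order $\mathcal T_\alpha$ by the initial-segment order $\sqsubseteq$, and let $\kappa(\lambda)$ be $\kappa$ of the last entry of $\lambda\in\mathcal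 T_\alpha$. Define $T_\lambda:L_p\to L_p$ by $T_{(\alpha)}=\mathrm{id}$, $T_{(\alpha,I)^\frown\mu}=T_IT_\mu$, and $T_{(\alpha)^\frown\mu}=T^\alpha_\beta T_\mu$ for limit $\alpha$ and $\mu\in\mathcal T_\beta$. Put $h^\lambda_I=T_\lambda h_I$ for $I\in\mathcal D_{\kappa(\lambda)-1}$ and $X_\lambda=T_\lambda(L_p^{\kappa(\lambda),0})$. **Theorem.** Let $\alpha<\omega_1$ and let $(\lambda_n,I_n)_n$ be an enumeration without repetition (a finite sequence if $\alpha$ is finite) of $\{(\lambda,I):\lambda\in\mathcal T_\alpha,\ I\in\mathcal D_{\kappa(\lambda)-1}\}$ such that for all $n<m$ one of the following holds: (a) $\lambda_n$ and $\lambda_m$ are incomparable; (b) $\lambda_n\sqsubsetneq\lambda_m$; (c) $\lambda_n=\lambda_m$ and $I_n<I_m$. Then: 1. $(h^{\lambda_n}_{I_n})_n$ is a martingale difference sequence, i.e. $\mathbb E(h^{\lambda_n}_{I_n}\mid h^{\lambda_1}_{I_1},\dots,h^{\lambda_{n-1}}_{I_{n-1}})=0$ for $n\ge2$, and $[(h^{\lambda_n}_{I_n})_n]=R_\alpha^{p,0}$.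 2. $(h^{\lambda_n}_{I_n})_n$ is an unconditional basis of $R_\alpha^{p,0}$: every $x\in R_\alpha^{p,0}$ has a unique norm-convergent expansion $x=\sum_n a_nh^{\lambda_n}_{I_n}$ with real $a_n$, and there is $C\ge1$ with $\|\sum_{n\le k}a_nh^{\lambda_n}_{I_n}\|\le C\|\sum_{n\le k}b_nh^{\lambda_n}_{I_n}\|$ whenever $|a_n|\le|b_n|$ for $n\le k$. 3. $(X_\lambda)_{\lambda\in\mathcal T_\alpha}$ is an unconditional FDD of $R_\alpha^{p,0}$: for every enumeration $(\nu_n)_n$ of $\mathcal T_\alpha$ without repetition, the $X_{\nu_n}$ are finite-dimensional (closed) subspaces of $R_\alpha^{p,0}$, every $x\in R_\alpha^{p,0}$ is uniquely a norm-convergent sum $x=\sum_nx_n$ with $x_n\in X_{\nu_n}$, and every sequence of nonzero vectors $x_n\in X_{\nu_n}$ is an unconditional basis of its closed linear span. -/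

import Mathlib

open MeasureTheory ProbabilityTheory Filter Topology
open scoped ENNReal Ordinal

noncomputable section

namespace BRS

/-! ### The space `L_p = L_p[0,1]` -/

/-- Lebesgue measure on `[0,1]`. -/
abbrev unitMeasure : Measure ℝ := volume.restrict (Set.Icc (0 : ℝ) 1)

instance isProbabilityMeasure_unitMeasure : IsProbabilityMeasure unitMeasure :=
  ⟨by simp [unitMeasure]⟩

/-- The real Banach space `L_p = L_p[0,1]`. -/
abbrev LpI (p : ℝ≥0∞) : Type := Lp ℝ p unitMeasure

/-- `L_p^0`: the functions of mean zero in `L_p`. -/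
def meanZero (p : ℝ≥0∞) [Fact (1 ≤ p)] : Submodule ℝ (LpI p) where
  carrier := {f | ∫ t, f t ∂unitMeasure = 0}
  add_mem' {f g} hf hg := by
    have hf' := (Lp.memLp f).integrable (Fact.out : 1 ≤ p)
    have hg' := (Lp.memLp g).integrable (Fact.out : 1 ≤ p)
    simp only [Set.mem_ofPred_eq] at hf hg ⊢
    rw [integral_congr_ae (Lp.coeFn_add f g)]
    simp only [Pi.add_apply]
    rw [integral_add hf' hg', hf, hg, add_zero]
  zero_mem' := by
    simp only [Set.mem_ofPred_eq]
    rw [integral_congr_ae (Lp.coeFn_zero ℝ p unitMeasure)]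
    simp
  smul_mem' c f hf := by
    simp only [Set.mem_ofPred_eq] at hf ⊢
    rw [integral_congr_ae (Lp.coeFn_smul c f)]
    simp only [Pi.smul_apply]
    rw [integral_smul, hf, smul_zero]

/-! ### The compressions `T_I` -/

/-- `T_I f` for `I = [a,b)`, as a function: `f((t-a)/(b-a))` on `[a,b)` and `0` elsewhere. -/
def compressFun (a b : ℝ) (f : ℝ → ℝ) : ℝ → ℝ :=
  (Set.Ico a b).indicator fun t => f ((t - a) / (b - a))

theorem measurable_rescale (a b : ℝ) : Measurable fun t : ℝ => (t - a) / (b - a) := by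
  fun_prop

theorem map_rescale_le {a b : ℝ} (hab : a < b) :
    Measure.map (fun t : ℝ => (t - a) / (b - a)) (unitMeasure.restrict (Set.Ico a b)) ≤
      ENNReal.ofReal (b - a) • unitMeasure := by
  have hc : 0 < b - a := sub_pos.2 hab
  have hvol : Measure.map (fun t : ℝ => (t - a) / (b - a)) volume =
      ENNReal.ofReal (b - a) • (volume : Measure ℝ) := by
    have h1 : (fun t : ℝ => (t - a) / (b - a)) =
        (fun t : ℝ => t * (b - a)⁻¹) ∘ fun t : ℝ => t - a := by
      funext t; simp [div_eq_mul_inv]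
    rw [h1, ← Measure.map_map (by fun_prop) (by fun_prop),
      (measurePreserving_sub_right volume a).map_eq,
      Real.map_volume_mul_right (inv_ne_zero hc.ne'), inv_inv, abs_of_pos hc]
  have hpre : (fun t : ℝ => (t - a) / (b - a)) ⁻¹' Set.Ico 0 1 = Set.Ico a b := by
    ext t
    simp only [Set.mem_preimage, Set.mem_Ico, le_div_iff₀ hc, div_lt_iff₀ hc]
    constructor <;> rintro ⟨h, h'⟩ <;> constructor <;> linarith
  calc Measure.map (fun t : ℝ => (t - a) / (b - a)) (unitMeasure.restrict (Set.Ico a b))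
      ≤ Measure.map (fun t : ℝ => (t - a) / (b - a)) (volume.restrict (Set.Ico a b)) :=
        Measure.map_mono (Measure.restrict_mono_measure Measure.restrict_le_self _)
          (measurable_rescale a b)
    _ = (ENNReal.ofReal (b - a) • (volume : Measure ℝ)).restrict (Set.Ico 0 1) := by
        rw [← hvol, Measure.restrict_map (measurable_rescale a b) measurableSet_Ico, hpre]
    _ ≤ ENNReal.ofReal (b - a) • unitMeasure := by
        rw [Measure.restrict_smul]
        gcongr
        exact Measure.restrict_mono Set.Ico_subset_Icc_self le_rfl

theorem quasiMeasurePreserving_rescale {a b : ℝ} (hab : a < b) :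
    Measure.QuasiMeasurePreserving (fun t : ℝ => (t - a) / (b - a))
      (unitMeasure.restrict (Set.Ico a b)) unitMeasure :=
  ⟨measurable_rescale a b,
    (Measure.absolutelyContinuous_of_le (map_rescale_le hab)).trans
      Measure.smul_absolutelyContinuous⟩

theorem memLp_compressFun {p : ℝ≥0∞} {a b : ℝ} (hab : a < b) (f : LpI p) :
    MemLp (compressFun a b f) p unitMeasure := by
  unfold compressFun
  rw [memLp_indicator_iff_restrict measurableSet_Ico]
  have h : MemLp f p (Measure.map (fun t : ℝ => (t - a) / (b - a))
      (unitMeasure.restrict (Set.Ico a b))) :=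
    ((Lp.memLp f).smul_measure ENNReal.ofReal_ne_top).mono_measure (map_rescale_le hab)
  exact h.comp_of_map (measurable_rescale a b).aemeasurable

theorem compressFun_congr {a b : ℝ} (hab : a < b) {f g : ℝ → ℝ} (h : f =ᵐ[unitMeasure] g) :
    compressFun a b f =ᵐ[unitMeasure] compressFun a b g := by
  have h1 := (quasiMeasurePreserving_rescale hab).ae_eq_comp h
  rw [Filter.EventuallyEq, ae_restrict_iff' measurableSet_Ico] at h1
  filter_upwards [h1] with t ht
  by_cases hmem : t ∈ Set.Ico a b
  · simpa [compressFun, hmem] using ht hmem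
  · simp [compressFun, hmem]

/-- The compression `T_I : L_p → L_p` for `I = [a,b) ⊆ [0,1)`. -/
def compress (p : ℝ≥0∞) (a b : ℝ) (hab : a < b) : LpI p →ₗ[ℝ] LpI p where
  toFun f := (memLp_compressFun hab f).toLp
  map_add' f g := by
    rw [← MemLp.toLp_add]
    apply MemLp.toLp_congr
    refine (compressFun_congr hab (Lp.coeFn_add f g)).trans (Eventually.of_forall fun t => ?_)
    by_cases hmem : t ∈ Set.Ico a b <;> simp [compressFun, hmem]
  map_smul' c f := by
    rw [RingHom.id_apply, ← MemLp.toLp_const_smul]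
    apply MemLp.toLp_congr
    refine (compressFun_congr hab (Lp.coeFn_smul c f)).trans (Eventually.of_forall fun t => ?_)
    by_cases hmem : t ∈ Set.Ico a b <;> simp [compressFun, hmem]

/-! ### Dyadic intervals and the Haar system -/

/-- A dyadic interval `[i/2^n, (i+1)/2^n)` of `[0,1)`, where `0 ≤ i < 2^n`. -/
@[ext]
structure Dyadic where
  /-- The exponent `n`: the interval belongs to `𝒟^n`. -/
  level : ℕ
  /-- The position `i`, counted from `0`. -/
  idx : ℕ
  idx_lt : idx < 2 ^ level

namespace Dyadic

/-- The left endpoint (the minimum) of the interval. -/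
def left (I : Dyadic) : ℝ := (I.idx : ℝ) / 2 ^ I.level

/-- The right endpoint of the interval. -/
def right (I : Dyadic) : ℝ := ((I.idx : ℝ) + 1) / 2 ^ I.level

theorem left_lt_right (I : Dyadic) : I.left < I.right := by
  unfold left right
  gcongr
  linarith

/-- The interval as a set of reals. -/
def toSet (I : Dyadic) : Set ℝ := Set.Ico I.left I.right

/-- The left half `I⁺`. -/
def plus (I : Dyadic) : Dyadic :=
  ⟨I.level + 1, 2 * I.idx, by have := I.idx_lt; rw [pow_succ]; omega⟩

/-- The right half `I⁻`. -/
def minus (I : Dyadic) : Dyadic :=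
  ⟨I.level + 1, 2 * I.idx + 1, by have := I.idx_lt; rw [pow_succ]; omega⟩

/-- The lexicographic order on dyadic intervals. -/
def LexLT (I J : Dyadic) : Prop :=
  I.level < J.level ∨ (I.level = J.level ∧ I.left < J.left)

/-- The characteristic function `χ_I` as an element of `L_p`. -/
def char (p : ℝ≥0∞) (I : Dyadic) : LpI p :=
  indicatorConstLp p (s := I.toSet) measurableSet_Ico (measure_ne_top unitMeasure _) (1 : ℝ)

/-- The Haar function `h_I = χ_{I⁺} - χ_{I⁻}`. -/
def haar (p : ℝ≥0∞) (I : Dyadic) : LpI p := I.plus.char p - I.minus.char p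

/-- The compression `T_I : L_p → L_p`. -/
def T (p : ℝ≥0∞) (I : Dyadic) : LpI p →ₗ[ℝ] LpI p := compress p I.left I.right I.left_lt_right

end Dyadic

/-- `L_p^{n,0}`: the mean-zero functions in the span of `(χ_I)_{I ∈ 𝒟^n}`. -/
def dyadicMeanZero (p : ℝ≥0∞) [Fact (1 ≤ p)] (n : ℕ) : Submodule ℝ (LpI p) :=
  Submodule.span ℝ (Dyadic.char p '' {I : Dyadic | I.level = n}) ⊓ meanZero p

/-! ### The spaces `R_α^p` and `R_α^{p,0}` -/

/-- A distributional embedding of `L_p` into itself: `dist (S f) = dist f` for every `f`. -/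
def IsDistributionalEmbedding {p : ℝ≥0∞} (S : LpI p →ₗ[ℝ] LpI p) : Prop :=
  ∀ f : LpI p, Measure.map (S f) unitMeasure = Measure.map f unitMeasure

/-- For every countable limit ordinal `α`, the operators `T α β : L_p → L_p`, `0 ≤ β < α`, are
distributional embeddings with independent ranges. (The other `T α β` are irrelevant.) -/
def IsIndependentSystem {p : ℝ≥0∞} (T : Ordinal.{0} → Ordinal.{0} → LpI p →ₗ[ℝ] LpI p) : Prop :=
  ∀ α : Ordinal.{0}, α < ω₁ → Order.IsSuccLimit α →
    (∀ β < α, IsDistributionalEmbedding (T α β)) ∧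
    ∀ f : Set.Iio α → LpI p,
      iIndepFun (fun (β : Set.Iio α) (t : ℝ) => T α β (f β) t) unitMeasure

/-- The Bourgain-Rosenthal-Schechtman space `R_α^p ⊆ L_p[0,1]`: the constants for `α = 0`,
`R_{β+1}^p = T_{[0,1/2)}(R_β^p) + T_{[1/2,1)}(R_β^p)`, and for limit `α` the closed linear span of
the `T α β (R_β^p)`, `β < α`. -/
def R {p : ℝ≥0∞} [Fact (1 ≤ p)] (T : Ordinal.{0} → Ordinal.{0} → LpI p →ₗ[ℝ] LpI p)
    (α : Ordinal.{0}) : Submodule ℝ (LpI p) :=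
  Ordinal.limitRecOn α
    (Submodule.span ℝ {Lp.const p unitMeasure (1 : ℝ)})
    (fun _ Rβ =>
      Rβ.map (compress p 0 (1 / 2) (by norm_num)) ⊔ Rβ.map (compress p (1 / 2) 1 (by norm_num)))
    (fun α _ Rlt =>
      (⨆ β : Set.Iio α, (Rlt β.1 β.2).map (T α β)).topologicalClosure)

/-- `R_α^{p,0}`: the mean-zero functions in `R_α^p`. -/
def R0 {p : ℝ≥0∞} [Fact (1 ≤ p)] (T : Ordinal.{0} → Ordinal.{0} → LpI p →ₗ[ℝ] LpI p)
    (α : Ordinal.{0}) : Submodule ℝ (LpI p) :=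
  R T α ⊓ meanZero p

/-! ### The trees `𝒯_α` -/

/-- The integer part `κ(α)` of an ordinal: `α = β + κ(α)` with `β` zero or a limit. -/
def kappa (α : Ordinal.{0}) : ℕ :=
  Ordinal.limitRecOn α 0 (fun _ k => k + 1) (fun _ _ _ => 0)

/-- The entries of the finite sequences in `𝒯_α`: ordinals and dyadic intervals. -/
inductive Entry : Type 1
  | ord (α : Ordinal.{0}) : Entry
  | int (I : Dyadic) : Entry

/-- `InTree α lam` means that the finite sequence `lam` belongs to `𝒯_α`. The constructors `head`
and `branch` concern successor ordinals `α = β + κ(α)` (then `β` is zero or a limit); for finite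
`α`, `branch` is void, since `𝒯_0` is empty. -/
inductive InTree : Ordinal.{0} → List Entry → Prop
  | head (α : Ordinal.{0}) : kappa α ≠ 0 → InTree α [Entry.ord α]
  | branch (α β : Ordinal.{0}) (I : Dyadic) (mu : List Entry) :
      kappa α ≠ 0 → α = β + (kappa α : Ordinal.{0}) → I.level = kappa α → InTree β mu →
      InTree α (Entry.ord α :: Entry.int I :: mu)
  | limit (α β : Ordinal.{0}) (mu : List Entry) :
      Order.IsSuccLimit α → 1 ≤ β → β < α → InTree β mu →
      InTree α (Entry.ord α :: mu)

/-- The tree `𝒯_α`; its order is the initial-segment order `<+:` of lists. -/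
def tree (α : Ordinal.{0}) : Set (List Entry) := {lam | InTree α lam}

/-- `κ(λ)`: the integer part of the last entry of `λ`. -/
def kappaSeq (lam : List Entry) : ℕ :=
  match lam.getLast? with
  | some (Entry.ord α) => kappa α
  | _ => 0

/-- The operator `T_λ : L_p → L_p`: `T_{(α)⌢μ} = T α β ∘ T_μ` when `μ` starts with the ordinal `β`,
`T_{(α,I)⌢μ} = T_I ∘ T_μ`, and `T_{(α)} = id`. -/
def opSeq {p : ℝ≥0∞} (T : Ordinal.{0} → Ordinal.{0} → LpI p →ₗ[ℝ] LpI p) :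
    List Entry → (LpI p →ₗ[ℝ] LpI p)
  | Entry.ord α :: Entry.ord β :: l => (T α β).comp (opSeq T (Entry.ord β :: l))
  | Entry.ord _ :: Entry.int I :: l => (I.T p).comp (opSeq T l)
  | _ => LinearMap.id

/-- `h_I^λ = T_λ(h_I)`. -/
def haarSeq {p : ℝ≥0∞} (T : Ordinal.{0} → Ordinal.{0} → LpI p →ₗ[ℝ] LpI p)
    (lam : List Entry) (I : Dyadic) : LpI p :=
  opSeq T lam (I.haar p)

/-- `X_λ = T_λ(L_p^{κ(λ),0})`. -/
def X {p : ℝ≥0∞} [Fact (1 ≤ p)] (T : Ordinal.{0} → Ordinal.{0} → LpI p →ₗ[ℝ] LpI p)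
    (lam : List Entry) : Submodule ℝ (LpI p) :=
  (dyadicMeanZero p (kappaSeq lam)).map (opSeq T lam)

/-- The set of pairs `(λ, I)` with `λ ∈ 𝒯_α` and `I ∈ 𝒟_{κ(λ)-1} = ⋃_{k < κ(λ)} 𝒟^k`. -/
def haarIndex (α : Ordinal.{0}) : Set (List Entry × Dyadic) :=
  {x | x.1 ∈ tree α ∧ x.2.level < kappaSeq x.1}

/-- `(s n)_{n < N}`, `N ∈ ℕ ∪ {∞}`, enumerates the set `S` without repetition. -/
def Enumerates {ι : Type*} (N : ℕ∞) (s : ℕ → ι) (S : Set ι) : Prop :=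
  Set.BijOn s {n : ℕ | (n : ℕ∞) < N} S

/-- For `n < m < N`: `λ_n`, `λ_m` are incomparable, or `λ_n` is a proper initial segment of `λ_m`, or
`λ_n = λ_m` and `I_n < I_m` lexicographically. -/
def Compatible (N : ℕ∞) (lam : ℕ → List Entry) (I : ℕ → Dyadic) : Prop :=
  ∀ n m : ℕ, n < m → (m : ℕ∞) < N →
    (¬ lam n <+: lam m ∧ ¬ lam m <+: lam n) ∨
    (lam n <+: lam m ∧ lam n ≠ lam m) ∨
    (lam n = lam m ∧ (I n).LexLT (I m))

/-! ### Martingale difference sequences, bases and decompositions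

Sequences have length `N ∈ ℕ ∪ {∞}` and are written `(e n)_{n < N}`; terms with `n ≥ N` are never
used. -/

/-- `(f n)_{n < N}` is a martingale difference sequence: `𝔼(f n | f 0, …, f (n-1)) = 0` for all
`1 ≤ n < N`. -/
def IsMDS {p : ℝ≥0∞} (N : ℕ∞) (f : ℕ → LpI p) : Prop :=
  ∀ n : ℕ, 1 ≤ n → (n : ℕ∞) < N →
    unitMeasure[(f n : ℝ → ℝ) |
      ⨆ k : Fin n, MeasurableSpace.comap (f k : ℝ → ℝ) (borel ℝ)] =ᵐ[unitMeasure] 0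

section Bases

variable {E : Type*} [NormedAddCommGroup E] [NormedSpace ℝ E]

/-- The closed linear span of `(e n)_{n < N}`. -/
def closedSpan (N : ℕ∞) (e : ℕ → E) : Submodule ℝ E :=
  (Submodule.span ℝ (e '' {n : ℕ | (n : ℕ∞) < N})).topologicalClosure

/-- `(e n)_{n < N}` is a Schauder basis of the subspace `Y`: the `e n` lie in `Y` and every `x ∈ Y`
has a unique expansion `x = ∑_{n < N} a n • e n`. -/
def IsSchauderBasis (N : ℕ∞) (Y : Submodule ℝ E) (e : ℕ → E) : Prop :=
  (∀ n : ℕ, (n : ℕ∞) < N → e n ∈ Y) ∧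
  ∀ x ∈ Y, ∃! a : ℕ → ℝ, (∀ n : ℕ, N ≤ (n : ℕ∞) → a n = 0) ∧
    Tendsto (fun k : ℕ => ∑ n ∈ Finset.range k, a n • e n) atTop (𝓝 x)

/-- `(e n)_{n < N}` is an unconditional Schauder basis of `Y`. -/
def IsUnconditionalBasis (N : ℕ∞) (Y : Submodule ℝ E) (e : ℕ → E) : Prop :=
  IsSchauderBasis N Y e ∧
  ∃ C : ℝ, 1 ≤ C ∧ ∀ k : ℕ, (k : ℕ∞) ≤ N → ∀ a b : ℕ → ℝ, (∀ n < k, |a n| ≤ |b n|) →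
    ‖∑ n ∈ Finset.range k, a n • e n‖ ≤ C * ‖∑ n ∈ Finset.range k, b n • e n‖

/-- `(F n)_{n < N}` is a Schauder decomposition of `Y`: the `F n` are closed subspaces of `Y` and
every `x ∈ Y` is uniquely `x = ∑_{n < N} y n` with `y n ∈ F n`. -/
def IsSchauderDecomposition (N : ℕ∞) (Y : Submodule ℝ E) (F : ℕ → Submodule ℝ E) : Prop :=
  (∀ n : ℕ, (n : ℕ∞) < N → F n ≤ Y ∧ IsClosed (F n : Set E)) ∧
  ∀ x ∈ Y, ∃! y : ℕ → E, (∀ n : ℕ, (n : ℕ∞) < N → y n ∈ F n) ∧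
    (∀ n : ℕ, N ≤ (n : ℕ∞) → y n = 0) ∧
    Tendsto (fun k : ℕ => ∑ n ∈ Finset.range k, y n) atTop (𝓝 x)

/-- `(F n)_{n < N}` is an unconditional finite-dimensional decomposition (FDD) of `Y`: a Schauder
decomposition into finite-dimensional subspaces such that all nonzero `x n ∈ F n` form an
unconditional basis of their closed linear span. -/
def IsUnconditionalFDD (N : ℕ∞) (Y : Submodule ℝ E) (F : ℕ → Submodule ℝ E) : Prop :=
  IsSchauderDecomposition N Y F ∧
  (∀ n : ℕ, (n : ℕ∞) < N → FiniteDimensional ℝ (F n)) ∧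
  ∀ x : ℕ → E, (∀ n : ℕ, (n : ℕ∞) < N → x n ∈ F n ∧ x n ≠ 0) →
    IsUnconditionalBasis N (closedSpan N x) x

end Bases

end BRS

end

noncomputable section

namespace BRS

/-! ### Burkholder's inequality -/

/-! Everything rests on one property of the system: each $h^\lambda_I$ is bounded by 1 and
orthogonal to all bounded measurable functions of the earlier terms
(`InTree.orthogonalToFamily_haarSeq`). It is proved by induction along $\lambda$. At a head
$(\alpha)$ only lexicographically earlier Haar functions may precede $h_I$; they are constant on
$I$, and $h_I$ has mean zero there. Below a branch $(\alpha,K)$, every function that may precede is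
on $K$ either constant or a compressed copy of one that may precede in the tree of $\beta$, and
rescaling $K$ to the unit interval reduces to $\beta$. Below a limit, functions from the same
$\beta$ are handled by the induction hypothesis because $T^\alpha_\beta$ preserves joint laws, while
functions from other indices are independent of its range and can be frozen by Fubini. The induction
closes only if the family of earlier functions may also contain constants.

Testing against indicators gives the martingale difference property. Unconditionality is
Burkholder's inequality for transforms by multipliers in $[-1,1]$ (`burkholder`). Its proof uses,
with $r=p/2$, the function $U(x,y)=2(\delta+x^2+y^2)^r-K(\delta+x^2+Ly^2)^r$. This $U$ lies below
its tangents in the directions $(1,\varepsilon)$, $|\varepsilon|\le1$, so $\mathbb E\,U$ does not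
increase along a martingale and its transform. It also dominates $|y|^p-C|x|^p$ up to a multiple of
$\delta^r$, and $\delta\to0$ gives the claim.

The closed span is identified by transfinite induction (`R0_eq_closure_haarSpan`). A copy $T_Jf$
splits into $(\mathbb Ef)\chi_J$ and a copy of the centred function. The former parts build step
functions, whose mean-zero combinations are spanned by the Haar functions of the head; the latter
come from the tree of $\beta$. At limits centring commutes with $T^\alpha_\beta$.

Finally, an unconditional constant bounds partial sums, which yields the basis, and it passes to
blocks with disjoint supports (`UnconditionalConst.blocks`). The $X_\lambda$ are spans of such
blocks, which yields the FDD. -/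

theorem le_tangent_of_deriv2_nonpos {G G' G'' : ℝ → ℝ} (h1 : ∀ t, HasDerivAt G (G' t) t)
    (h2 : ∀ t, HasDerivAt G' (G'' t) t) (h3 : ∀ t, G'' t ≤ 0) (t : ℝ) :
    G t ≤ G 0 + G' 0 * t := by
  have hanti : Antitone G' := antitone_of_hasDerivAt_nonpos h2 h3
  have hD : ∀ t, HasDerivAt (fun t => G t - G' 0 * t) (G' t - G' 0) t := fun t => by
    exact ((h1 t).sub ((hasDerivAt_id t).const_mul (G' 0))).congr_deriv (by simp)
  have hdiff : Differentiable ℝ (fun t => G t - G' 0 * t) := fun t => (hD t).differentiableAt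
  rcases le_total 0 t with ht | ht
  · have := antitoneOn_of_deriv_nonpos (convex_Ici (0 : ℝ)) hdiff.continuous.continuousOn
      hdiff.differentiableOn (fun x hx => by
        rw [(hD x).deriv]; rw [interior_Ici] at hx
        linarith [hanti (le_of_lt (Set.mem_Ioi.1 hx))])
    have := this (Set.self_mem_Ici) (Set.mem_Ici.2 ht) ht
    simp only [mul_zero, sub_zero] at this
    linarith
  · have := monotoneOn_of_deriv_nonneg (convex_Iic (0 : ℝ)) hdiff.continuous.continuousOn
      hdiff.differentiableOn (fun x hx => by
        rw [(hD x).deriv]; rw [interior_Iic] at hx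
        linarith [hanti (le_of_lt (Set.mem_Iio.1 hx))])
    have := this (Set.mem_Iic.2 ht) (Set.self_mem_Iic) ht
    simp only [mul_zero, sub_zero] at this
    linarith

/-- The quadratic form `δ + x² + c y²`. -/
def quad (δ c x y : ℝ) : ℝ := δ + x ^ 2 + c * y ^ 2

theorem quad_pos {δ c : ℝ} (hδ : 0 < δ) (hc : 0 < c) (x y : ℝ) : 0 < quad δ c x y := by
  unfold quad; positivity

/-- Half the derivative of `quad` in the direction `(1, ε)`. -/
def dquad (c ε x y : ℝ) : ℝ := x + c * ε * y

/-- Cauchy–Schwarz for the form `x² + c y²`, applied to `(x, y)` and `(1, ε)`; the term `δ` only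
helps. -/
theorem dquad_sq_le {δ c ε : ℝ} (hδ : 0 < δ) (hc : 0 < c) (x y : ℝ) :
    dquad c ε x y ^ 2 ≤ (1 + c * ε ^ 2) * quad δ c x y := by
  unfold dquad quad
  have h : (1 + c * ε ^ 2) * (δ + x ^ 2 + c * y ^ 2) - (x + c * ε * y) ^ 2
      = δ * (1 + c * ε ^ 2) + c * (ε * x - y) ^ 2 := by ring
  have : 0 ≤ δ * (1 + c * ε ^ 2) + c * (ε * x - y) ^ 2 := by positivity
  linarith

theorem hasDerivAt_quad_rpow {δ c : ℝ} (hδ : 0 < δ) (hc : 0 < c) (r ε x y t : ℝ) :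
    HasDerivAt (fun t => quad δ c (x + t) (y + ε * t) ^ r)
      (2 * r * (quad δ c (x + t) (y + ε * t) ^ (r - 1) * dquad c ε (x + t) (y + ε * t))) t := by
  have hq : HasDerivAt (fun t => quad δ c (x + t) (y + ε * t))
      (2 * dquad c ε (x + t) (y + ε * t)) t := by
    have h1 : HasDerivAt (fun t : ℝ => x + t) 1 t := (hasDerivAt_id t).const_add x
    have h2 : HasDerivAt (fun t : ℝ => y + ε * t) ε t := by
      exact (((hasDerivAt_id t).const_mul ε).const_add y).congr_deriv (by simp)
    exact (((h1.pow 2).const_add δ).add ((h2.pow 2).const_mul c)).congr_deriv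
      (by simp [dquad]; ring)
  exact (hq.rpow_const (p := r) (Or.inl (quad_pos hδ hc _ _).ne')).congr_deriv (by ring)

theorem hasDerivAt_quad_rpow_two {δ c : ℝ} (hδ : 0 < δ) (hc : 0 < c) (r ε x y t : ℝ) :
    HasDerivAt (fun t => quad δ c (x + t) (y + ε * t) ^ (r - 1) * dquad c ε (x + t) (y + ε * t))
      (quad δ c (x + t) (y + ε * t) ^ (r - 2) *
        (2 * (r - 1) * dquad c ε (x + t) (y + ε * t) ^ 2 +
          (1 + c * ε ^ 2) * quad δ c (x + t) (y + ε * t))) t := by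
  have h1 := hasDerivAt_quad_rpow hδ hc (r - 1) ε x y t
  have h2 : HasDerivAt (fun t => dquad c ε (x + t) (y + ε * t)) (1 + c * ε ^ 2) t := by
    have h1 : HasDerivAt (fun t : ℝ => x + t) 1 t := (hasDerivAt_id t).const_add x
    have h2 : HasDerivAt (fun t : ℝ => y + ε * t) ε t := by
      exact (((hasDerivAt_id t).const_mul ε).const_add y).congr_deriv (by simp)
    exact (h1.add (h2.const_mul (c * ε))).congr_deriv (by ring)
  refine (h1.mul h2).congr_deriv ?_
  have hpos := quad_pos hδ hc (x + t) (y + ε * t)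
  have e1 : quad δ c (x + t) (y + ε * t) ^ (r - 1) =
      quad δ c (x + t) (y + ε * t) ^ (r - 2) * quad δ c (x + t) (y + ε * t) := by
    rw [← Real.rpow_add_one hpos.ne']; ring_nf
  have e2 : r - 1 - 1 = r - 2 := by ring
  rw [e2, e1]; ring

/-- Up to the factor `2 r quad ^ (r - 2)`, the left side is the second derivative of `quad ^ r`
along `(1, ε)`. Since `dquad ^ 2` lies between `0` and `(1 + c ε²) quad`, the expression lies
between `1` and `2r - 1` times that bound. Both numbers are positive when `r > 1/2`, that is, `p >
1`. -/
theorem quad_second_le {δ c : ℝ} (hδ : 0 < δ) (hc : 0 < c) (r ε x y : ℝ) :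
    2 * (r - 1) * dquad c ε x y ^ 2 + (1 + c * ε ^ 2) * quad δ c x y ≤
      max 1 (2 * r - 1) * ((1 + c * ε ^ 2) * quad δ c x y) := by
  have h := dquad_sq_le (ε := ε) hδ hc x y
  have h0 : 0 ≤ dquad c ε x y ^ 2 := sq_nonneg _
  rcases le_total r 1 with hr | hr
  · rw [max_eq_left (by linarith)]; nlinarith
  · rw [max_eq_right (by linarith)]; nlinarith

theorem le_quad_second {δ c : ℝ} (hδ : 0 < δ) (hc : 0 < c) (r ε x y : ℝ) :
    min 1 (2 * r - 1) * ((1 + c * ε ^ 2) * quad δ c x y) ≤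
      2 * (r - 1) * dquad c ε x y ^ 2 + (1 + c * ε ^ 2) * quad δ c x y := by
  have h := dquad_sq_le (ε := ε) hδ hc x y
  have h0 : 0 ≤ dquad c ε x y ^ 2 := sq_nonneg _
  rcases le_total r 1 with hr | hr
  · rw [min_eq_right (by linarith)]; nlinarith
  · rw [min_eq_left (by linarith)]; nlinarith

/-- Admissible constants for the Burkholder function with exponent `r = p/2`. -/
structure BurkholderConst (r L K : ℝ) : Prop where
  L_pos : 0 < L
  L_le : L ≤ 1
  K_pos : 0 < K
  KL : K * (3 * L) ^ r ≤ 1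
  dom : ∀ s S : ℝ, 0 < S → L * S ≤ s → s ≤ S →
    4 * max 1 (2 * r - 1) * S ^ (r - 1) ≤ K * min 1 (2 * r - 1) * s ^ (r - 1)

/-- Taking `K = (3L)^(-r)` makes `KL` an equality, so only `L` has to be small. For `r ≤ 1` one has
`S^(r-1) ≤ s^(r-1)`, and `K ≥ Q` suffices. For `r ≥ 1` the worst case is `s = L S`, and `K L^(r-1) =
3^(-r) / L ≥ Q` suffices. -/
theorem exists_burkholderConst {r : ℝ} (hr : 1 / 2 < r) : ∃ L K, BurkholderConst r L K := by
  have hm : 0 < min 1 (2 * r - 1) := lt_min one_pos (by linarith)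
  have hM : 0 < max 1 (2 * r - 1) := lt_max_of_lt_left one_pos
  set m := min 1 (2 * r - 1)
  set Mx := max 1 (2 * r - 1)
  set Q := 4 * Mx / m with hQ
  have hQ0 : 0 < Q := by positivity
  have hQm : Q * m = 4 * Mx := by rw [hQ]; field_simp
  rcases le_total r 1 with h1 | h1
  · have hL0 : 0 < min 1 (Q ^ (-(1 / r)) / 3) := lt_min one_pos (by positivity)
    refine ⟨min 1 (Q ^ (-(1 / r)) / 3), (3 * min 1 (Q ^ (-(1 / r)) / 3)) ^ (-r), hL0,
      min_le_left _ _, by positivity, ?_, ?_⟩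
    · rw [← Real.rpow_add (by positivity)]; simp
    · intro s S hS h2 h3
      set L := min 1 (Q ^ (-(1 / r)) / 3)
      have hs : 0 < s := lt_of_lt_of_le (by positivity) h2
      have hK : Q ≤ (3 * L) ^ (-r) := by
        have : 3 * L ≤ Q ^ (-(1 / r)) := by
          have := min_le_right 1 (Q ^ (-(1 / r)) / 3); linarith
        calc Q = (Q ^ (-(1 / r))) ^ (-r) := by
              rw [← Real.rpow_mul hQ0.le]
              have : -(1 / r) * -r = 1 := by field_simp
              rw [this, Real.rpow_one]
          _ ≤ _ := Real.rpow_le_rpow_of_nonpos (by positivity) this (by linarith)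
      have h4 : S ^ (r - 1) ≤ s ^ (r - 1) := Real.rpow_le_rpow_of_nonpos hs h3 (by linarith)
      rw [← hQm]
      gcongr
  · have hL0 : 0 < min 1 (1 / (3 ^ r * Q)) := lt_min one_pos (by positivity)
    refine ⟨min 1 (1 / (3 ^ r * Q)), (3 * min 1 (1 / (3 ^ r * Q))) ^ (-r), hL0,
      min_le_left _ _, by positivity, ?_, ?_⟩
    · rw [← Real.rpow_add (by positivity)]; simp
    · intro s S hS h2 h3
      set L := min 1 (1 / (3 ^ r * Q))
      have hs : 0 < s := lt_of_lt_of_le (by positivity) h2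
      have h4 : (L * S) ^ (r - 1) ≤ s ^ (r - 1) :=
        Real.rpow_le_rpow (by positivity) h2 (by linarith)
      have hL : L * (3 ^ r * Q) ≤ 1 := by
        have := min_le_right 1 (1 / (3 ^ r * Q))
        rwa [← le_div_iff₀ (by positivity)]
      have h5 : Q ≤ (3 * L) ^ (-r) * L ^ (r - 1) := by
        rw [Real.mul_rpow (by norm_num) hL0.le, mul_assoc, ← Real.rpow_add hL0]
        have : -r + (r - 1) = -1 := by ring
        rw [this, Real.rpow_neg_one, Real.rpow_neg (by norm_num), ← mul_inv,
          le_inv_comm₀ hQ0 (by positivity)]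
        rw [inv_eq_one_div, le_div_iff₀ hQ0]
        linarith
      calc 4 * Mx * S ^ (r - 1) = Q * m * S ^ (r - 1) := by rw [hQm]
        _ ≤ ((3 * L) ^ (-r) * L ^ (r - 1)) * m * S ^ (r - 1) := by gcongr
        _ = (3 * L) ^ (-r) * m * (L * S) ^ (r - 1) := by
            rw [Real.mul_rpow hL0.le hS.le]; ring
        _ ≤ _ := by gcongr

/-- A (smooth) Burkholder function. -/
def bfun (r L K δ x y : ℝ) : ℝ := 2 * quad δ 1 x y ^ r - K * quad δ L x y ^ r

/-- The derivative of `bfun` in the direction `(1, ε)`. -/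
def bfunDeriv (r L K δ ε x y : ℝ) : ℝ :=
  2 * (2 * r * (quad δ 1 x y ^ (r - 1) * dquad 1 ε x y)) -
    K * (2 * r * (quad δ L x y ^ (r - 1) * dquad L ε x y))

/-- The second derivative along `(1, ε)` is `2r (2P - K W)`, and `dom` makes the subtracted term
win. The `4` in `dom` is the coefficient `2` of `bfun` times the bound `1 + ε² ≤ 2`. Positivity of
`δ` keeps both forms away from zero, so the powers are smooth even for small `r`. -/
theorem bfun_le_tangent {r L K δ ε : ℝ} (hr : 1 / 2 < r) (hc : BurkholderConst r L K) (hδ : 0 < δ)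
    (hε : |ε| ≤ 1) (x y t : ℝ) :
    bfun r L K δ (x + t) (y + ε * t) ≤ bfun r L K δ x y + bfunDeriv r L K δ ε x y * t := by
  have hε2 : ε ^ 2 ≤ 1 := (sq_le_one_iff_abs_le_one ε).2 hε
  have key := le_tangent_of_deriv2_nonpos
    (G := fun t => bfun r L K δ (x + t) (y + ε * t))
    (G' := fun t => bfunDeriv r L K δ ε (x + t) (y + ε * t))
    (fun t => ((hasDerivAt_quad_rpow hδ one_pos r ε x y t).const_mul 2).sub
      ((hasDerivAt_quad_rpow hδ hc.L_pos r ε x y t).const_mul K))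
    (fun t => (((hasDerivAt_quad_rpow_two hδ one_pos r ε x y t).const_mul (2 * r)).const_mul 2).sub
      (((hasDerivAt_quad_rpow_two hδ hc.L_pos r ε x y t).const_mul (2 * r)).const_mul K))
    (fun t => ?_) t
  · simpa using key
  set x' := x + t
  set y' := y + ε * t
  have hS := quad_pos hδ one_pos x' y'
  have hs := quad_pos hδ hc.L_pos x' y'
  have hdom := hc.dom (quad δ L x' y') (quad δ 1 x' y') hS
    (by unfold quad; nlinarith [hc.L_le, hc.L_pos, sq_nonneg x', sq_nonneg y'])
    (by unfold quad; nlinarith [hc.L_le, hc.L_pos, sq_nonneg x', sq_nonneg y'])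
  have e : ∀ {q : ℝ}, 0 < q → q ^ (r - 1) = q ^ (r - 2) * q := fun hq => by
    rw [← Real.rpow_add_one hq.ne']; ring_nf
  have A := mul_le_mul_of_nonneg_left (quad_second_le hδ one_pos r ε x' y')
    (Real.rpow_nonneg hS.le (r - 2))
  have B := mul_le_mul_of_nonneg_left (le_quad_second hδ hc.L_pos r ε x' y')
    (Real.rpow_nonneg hs.le (r - 2))
  set P := quad δ 1 x' y' ^ (r - 2) * (2 * (r - 1) * dquad 1 ε x' y' ^ 2 +
    (1 + 1 * ε ^ 2) * quad δ 1 x' y')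
  set W := quad δ L x' y' ^ (r - 2) * (2 * (r - 1) * dquad L ε x' y' ^ 2 +
    (1 + L * ε ^ 2) * quad δ L x' y')
  have A' : P ≤ 2 * (max 1 (2 * r - 1) * quad δ 1 x' y' ^ (r - 1)) := by
    refine A.trans ?_
    have : (quad δ 1 x' y' ^ (r - 2) * (max 1 (2 * r - 1) * ((1 + 1 * ε ^ 2) * quad δ 1 x' y')))
        = (1 + ε ^ 2) * (max 1 (2 * r - 1) * quad δ 1 x' y' ^ (r - 1)) := by rw [e hS]; ring
    rw [this]
    have : 0 ≤ max 1 (2 * r - 1) * quad δ 1 x' y' ^ (r - 1) := by positivity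
    gcongr; linarith
  have hm : 0 ≤ min 1 (2 * r - 1) := le_min zero_le_one (by linarith)
  have B' : min 1 (2 * r - 1) * quad δ L x' y' ^ (r - 1) ≤ W := by
    refine le_trans ?_ B
    have : (quad δ L x' y' ^ (r - 2) * (min 1 (2 * r - 1) * ((1 + L * ε ^ 2) * quad δ L x' y')))
        = (1 + L * ε ^ 2) * (min 1 (2 * r - 1) * quad δ L x' y' ^ (r - 1)) := by rw [e hs]; ring
    rw [this]
    have h0 : 0 ≤ min 1 (2 * r - 1) * quad δ L x' y' ^ (r - 1) := by positivity
    have := mul_nonneg hc.L_pos.le (sq_nonneg ε)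
    nlinarith
  have B'' := mul_le_mul_of_nonneg_left B' hc.K_pos.le
  have : 2 * P - K * W ≤ 0 := by linarith
  have h2r : 0 ≤ 2 * r := by linarith
  calc 2 * (2 * r * P) - K * (2 * r * W) = 2 * r * (2 * P - K * W) := by ring
    _ ≤ 0 := mul_nonpos_of_nonneg_of_nonpos h2r this

/-- The first term of `bfun` supplies `2|y|^p`. The subtracted one is split by `(a + b + c)^r ≤ 3^r
(a^r + b^r + c^r)`, and by `KL` its `y`-part costs at most one `|y|^p`. -/
theorem abs_rpow_le_bfun {r L K δ : ℝ} (hr : 1 / 2 < r) (hc : BurkholderConst r L K) (hδ : 0 < δ)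
    (x y : ℝ) :
    |y| ^ (2 * r) - K * 3 ^ r * |x| ^ (2 * r) - K * 3 ^ r * δ ^ r ≤ bfun r L K δ x y := by
  have h1 : |y| ^ (2 * r) ≤ quad δ 1 x y ^ r := by
    rw [Real.rpow_mul (abs_nonneg y), Real.rpow_two, sq_abs]
    exact Real.rpow_le_rpow (sq_nonneg y) (by unfold quad; nlinarith [sq_nonneg x]) (by linarith)
  have hx : |x| ^ (2 * r) = (x ^ 2) ^ r := by
    rw [Real.rpow_mul (abs_nonneg x), Real.rpow_two, sq_abs]
  have hy : |y| ^ (2 * r) = (y ^ 2) ^ r := by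
    rw [Real.rpow_mul (abs_nonneg y), Real.rpow_two, sq_abs]
  have hr0 : 0 ≤ r := by linarith
  have h2 : quad δ L x y ^ r ≤ 3 ^ r * (δ ^ r + (x ^ 2) ^ r + L ^ r * (y ^ 2) ^ r) := by
    have hLy : 0 ≤ L * y ^ 2 := mul_nonneg hc.L_pos.le (sq_nonneg y)
    rw [← Real.mul_rpow hc.L_pos.le (sq_nonneg y)]
    set M := max δ (max (x ^ 2) (L * y ^ 2))
    have hM0 : 0 ≤ M := le_max_of_le_left hδ.le
    have : quad δ L x y ≤ 3 * M := by
      have a1 : δ ≤ M := le_max_left _ _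
      have a2 : x ^ 2 ≤ M := le_max_of_le_right (le_max_left _ _)
      have a3 : L * y ^ 2 ≤ M := le_max_of_le_right (le_max_right _ _)
      unfold quad; linarith
    calc quad δ L x y ^ r ≤ (3 * M) ^ r :=
          Real.rpow_le_rpow (quad_pos hδ hc.L_pos _ _).le this hr0
      _ = 3 ^ r * M ^ r := Real.mul_rpow (by norm_num) hM0
      _ ≤ _ := by
          gcongr
          have b1 : 0 ≤ δ ^ r := by positivity
          have b2 : 0 ≤ (x ^ 2) ^ r := by positivity
          have b3 : 0 ≤ (L * y ^ 2) ^ r := by positivity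
          rcases max_choice δ (max (x ^ 2) (L * y ^ 2)) with h | h
          · simp only [M, h]; linarith
          · simp only [M, h]
            rcases max_choice (x ^ 2) (L * y ^ 2) with h | h <;> rw [h] <;> linarith
  have h3 := mul_le_mul_of_nonneg_left h2 hc.K_pos.le
  have h4 : K * 3 ^ r * L ^ r ≤ 1 := by
    have := hc.KL
    rwa [Real.mul_rpow (by norm_num) hc.L_pos.le, ← mul_assoc] at this
  have h5 : K * 3 ^ r * L ^ r * (y ^ 2) ^ r ≤ 1 * (y ^ 2) ^ r :=
    mul_le_mul_of_nonneg_right h4 (by positivity)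
  unfold bfun
  rw [hx]
  rw [hy] at h1 ⊢
  nlinarith

theorem continuous_bfun {r L K δ : ℝ} (hc : BurkholderConst r L K) (hδ : 0 < δ) :
    Continuous fun z : ℝ × ℝ => bfun r L K δ z.1 z.2 := by
  have h : ∀ {c : ℝ}, 0 < c → Continuous fun z : ℝ × ℝ => quad δ c z.1 z.2 ^ r := fun hc' =>
    Continuous.rpow_const (by unfold quad; fun_prop) fun z => Or.inl (quad_pos hδ hc' _ _).ne'
  exact ((h one_pos).const_mul 2).sub ((h hc.L_pos).const_mul K)

theorem continuous_bfunDeriv {r L K δ : ℝ} (hc : BurkholderConst r L K) (hδ : 0 < δ) (ε : ℝ) :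
    Continuous fun z : ℝ × ℝ => bfunDeriv r L K δ ε z.1 z.2 := by
  have h : ∀ {c : ℝ}, 0 < c → Continuous fun z : ℝ × ℝ => quad δ c z.1 z.2 ^ (r - 1) := fun hc' =>
    Continuous.rpow_const (by unfold quad; fun_prop) fun z => Or.inl (quad_pos hδ hc' _ _).ne'
  have h1 := h one_pos
  have h2 := h hc.L_pos
  unfold bfunDeriv dquad
  fun_prop

theorem exists_bound_of_continuous {Φ : ℝ × ℝ → ℝ} (hΦ : Continuous Φ) (M : ℝ) :
    ∃ C, ∀ x y, |x| ≤ M → |y| ≤ M → |Φ (x, y)| ≤ C := by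
  obtain ⟨C, hC⟩ := ((isCompact_Icc (a := -M) (b := M)).prod
    (isCompact_Icc (a := -M) (b := M))).exists_bound_of_continuousOn hΦ.continuousOn
  exact ⟨C, fun x y hx hy => hC (x, y) ⟨abs_le.1 hx, abs_le.1 hy⟩⟩

/-! ### Transforms of bounded martingale differences. -/

section Martingale

variable {Ω : Type*} [MeasurableSpace Ω] {P : Measure Ω}

theorem integrable_continuous_comp [IsProbabilityMeasure P] {Φ : ℝ × ℝ → ℝ} (hΦ : Continuous Φ)
    {f g : Ω → ℝ} (hf : Measurable f) (hg : Measurable g) {M : ℝ}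
    (hfM : ∀ w, |f w| ≤ M) (hgM : ∀ w, |g w| ≤ M) :
    Integrable (fun w => Φ (f w, g w)) P := by
  obtain ⟨C, hC⟩ := exists_bound_of_continuous hΦ M
  exact Integrable.of_bound (hΦ.measurable.comp (hf.prodMk hg)).aestronglyMeasurable C
    (Eventually.of_forall fun w => hC _ _ (hfM w) (hgM w))

/-- The sequence `H 0, …, H (k-1)` is orthogonal to the past, tested against bounded functions. -/
def OrthogonalToPast (P : Measure Ω) (k : ℕ) (H : ℕ → Ω → ℝ) : Prop :=
  ∀ n < k, ∀ ψ : (Fin n → ℝ) → ℝ, Measurable ψ → (∃ C, ∀ v, |ψ v| ≤ C) →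
    ∫ w, ψ (fun i => H i w) * H n w ∂P = 0

theorem abs_sum_le_of_abs_le_one {c H : ℕ → ℝ} (hH : ∀ n, |H n| ≤ 1) (k : ℕ) :
    |∑ n ∈ Finset.range k, c n * H n| ≤ ∑ n ∈ Finset.range k, |c n| := by
  refine (Finset.abs_sum_le_sum_abs _ _).trans (Finset.sum_le_sum fun n _ => ?_)
  rw [abs_mul]
  exact mul_le_of_le_one_right (abs_nonneg _) (hH n)

/-- Truncation to `[-1, 1]`. -/
def clip (x : ℝ) : ℝ := max (-1) (min 1 x)

theorem abs_clip_le (x : ℝ) : |clip x| ≤ 1 :=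
  abs_le.2 ⟨le_max_left _ _, max_le (by norm_num) (min_le_left _ _)⟩

theorem clip_of_abs_le {x : ℝ} (hx : |x| ≤ 1) : clip x = x := by
  rw [abs_le] at hx; simp [clip, hx.1, hx.2]

theorem measurable_clip : Measurable clip := by unfold clip; fun_prop

theorem OrthogonalToPast.integral_continuous_mul {k : ℕ} {H : ℕ → Ω → ℝ}
    (hH : OrthogonalToPast P k H) (hHb : ∀ n w, |H n w| ≤ 1) {Φ : ℝ × ℝ → ℝ} (hΦ : Continuous Φ)
    {n : ℕ} (hn : n < k) (c d : ℕ → ℝ) :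
    ∫ w, Φ (∑ i ∈ Finset.range n, c i * H i w, ∑ i ∈ Finset.range n, d i * H i w) * H n w ∂P
      = 0 := by
  obtain ⟨C, hC⟩ := exists_bound_of_continuous hΦ
    (max (∑ i ∈ Finset.range n, |c i|) (∑ i ∈ Finset.range n, |d i|))
  -- A test function must be bounded on all of `ℝⁿ`, so the coordinates are clipped first; on values
  -- of `H` this changes nothing. The value `0` for `i ≥ n` never enters the sums.
  let ext : (Fin n → ℝ) → ℕ → ℝ := fun v i => if h : i < n then clip (v ⟨i, h⟩) else 0
  have hext : ∀ v i, |ext v i| ≤ 1 := fun v i => by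
    by_cases h : i < n
    · simpa [ext, h] using abs_clip_le _
    · simp [ext, h]
  have hextm : ∀ i, Measurable fun v => ext v i := fun i => by
    by_cases h : i < n
    · simp only [ext, h, dif_pos]
      exact measurable_clip.comp (measurable_pi_apply _)
    · simp [ext, h]
  have hsm : ∀ a : ℕ → ℝ, Measurable fun v => ∑ i ∈ Finset.range n, a i * ext v i := fun a =>
    Finset.measurable_fun_sum _ fun i _ => (hextm i).const_mul (a i)
  have := hH n hn
    (fun v => Φ (∑ i ∈ Finset.range n, c i * ext v i, ∑ i ∈ Finset.range n, d i * ext v i))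
    (hΦ.measurable.comp ((hsm c).prodMk (hsm d))) ⟨C, fun v => hC _ _
      ((abs_sum_le_of_abs_le_one (hext v) n).trans (le_max_left _ _))
      ((abs_sum_le_of_abs_le_one (hext v) n).trans (le_max_right _ _))⟩
  rw [← this]
  congr 1
  funext w
  have e : ∀ a : ℕ → ℝ, ∑ i ∈ Finset.range n, a i * ext (fun i => H i w) i =
      ∑ i ∈ Finset.range n, a i * H i w := fun a => Finset.sum_congr rfl fun i hi => by
    simp [ext, Finset.mem_range.1 hi, clip_of_abs_le (hHb i w)]
  rw [e c, e d]

/-- The integral does not increase with `k`: the tangent inequality at the current pair, in the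
direction `(1, θ k)`, adds a linear term that is a continuous function of the past times `H k`, and
its integral vanishes. The starting value is `(2 - K) δ^r`. -/
theorem integral_bfun_le [IsProbabilityMeasure P] {r L K δ : ℝ} (hr : 1 / 2 < r)
    (hc : BurkholderConst r L K) (hδ : 0 < δ)
    {H : ℕ → Ω → ℝ} (hHm : ∀ n, Measurable (H n)) (hHb : ∀ n w, |H n w| ≤ 1) {k : ℕ}
    (hH : OrthogonalToPast P k H) (b θ : ℕ → ℝ) (hθ : ∀ n, |θ n| ≤ 1) :
    ∫ w, bfun r L K δ (∑ n ∈ Finset.range k, b n * H n w)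
      (∑ n ∈ Finset.range k, θ n * b n * H n w) ∂P ≤ 2 * δ ^ r := by
  induction k with
  | zero =>
    simp only [Finset.range_zero, Finset.sum_empty, integral_const, probReal_univ, smul_eq_mul,
      one_mul, bfun, quad]
    have : 0 ≤ K * δ ^ r := mul_nonneg hc.K_pos.le (by positivity)
    simpa using this
  | succ k ih =>
    refine le_trans ?_ (ih fun n hn => hH n (by omega))
    set f : Ω → ℝ := fun w => ∑ n ∈ Finset.range k, b n * H n w
    set g : Ω → ℝ := fun w => ∑ n ∈ Finset.range k, θ n * b n * H n w
    have hmeas : ∀ (c : ℕ → ℝ) (k : ℕ), Measurable fun w => ∑ n ∈ Finset.range k, c n * H n w :=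
      fun c k => Finset.measurable_fun_sum _ fun n _ => (hHm n).const_mul (c n)
    have hle : ∀ (c : ℕ → ℝ), (∀ n, |c n| ≤ |b n|) → ∀ l ≤ k + 1, ∀ w,
        |∑ n ∈ Finset.range l, c n * H n w| ≤ ∑ n ∈ Finset.range (k + 1), |b n| := by
      intro c hcb l hl w
      refine (abs_sum_le_of_abs_le_one (fun n => hHb n w) l).trans ?_
      refine (Finset.sum_le_sum fun n _ => hcb n).trans ?_
      exact Finset.sum_le_sum_of_subset_of_nonneg
        (Finset.range_subset_range.2 hl) fun _ _ _ => abs_nonneg _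
    have hθb : ∀ n, |θ n * b n| ≤ |b n| := fun n => by
      rw [abs_mul]; exact mul_le_of_le_one_left (abs_nonneg _) (hθ n)
    have hU : ∀ l ≤ k + 1, Integrable (fun w => bfun r L K δ (∑ n ∈ Finset.range l, b n * H n w)
        (∑ n ∈ Finset.range l, θ n * b n * H n w)) P := fun l hl =>
      integrable_continuous_comp (continuous_bfun hc hδ) (hmeas _ _) (hmeas _ _)
        (hle _ (fun _ => le_rfl) l hl) (hle _ hθb l hl)
    have hDc := continuous_bfunDeriv hc hδ (θ k)
    have hD : Integrable (fun w => bfunDeriv r L K δ (θ k) (f w) (g w)) P :=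
      integrable_continuous_comp hDc (hmeas _ _) (hmeas _ _)
        (hle _ (fun _ => le_rfl) k (by omega)) (hle _ hθb k (by omega))
    have hDH : Integrable (fun w => bfunDeriv r L K δ (θ k) (f w) (g w) * (b k * H k w)) P :=
      hD.mul_bdd (c := |b k|) ((hHm k).const_mul _).aestronglyMeasurable
        (Eventually.of_forall fun w => by
          rw [Real.norm_eq_abs, abs_mul]
          exact mul_le_of_le_one_right (abs_nonneg _) (hHb k w))
    have hzero : ∫ w, bfunDeriv r L K δ (θ k) (f w) (g w) * (b k * H k w) ∂P = 0 := by
      have := hH.integral_continuous_mul hHb hDc (Nat.lt_succ_self k) b (fun n => θ n * b n)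
      simp_rw [mul_left_comm _ (b k), integral_const_mul]
      exact mul_eq_zero_of_right _ this
    calc _ ≤ ∫ w, (bfun r L K δ (f w) (g w) +
            bfunDeriv r L K δ (θ k) (f w) (g w) * (b k * H k w)) ∂P := by
          refine integral_mono (hU (k + 1) le_rfl) ((hU k (by omega)).add hDH) fun w => ?_
          simp only [Finset.sum_range_succ]
          have := bfun_le_tangent hr hc hδ (hθ k) (f w) (g w) (b k * H k w)
          rwa [← mul_assoc] at this
      _ = _ := by rw [integral_add (hU k (by omega)) hDH, hzero, add_zero]

/-- **Burkholder's inequality** for bounded martingale difference sequences. -/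
theorem burkholder {p : ℝ} (hp : 1 < p) : ∃ C : ℝ, 0 < C ∧
    ∀ {Ω : Type} [MeasurableSpace Ω] (P : Measure Ω) [IsProbabilityMeasure P]
    {H : ℕ → Ω → ℝ}, (∀ n, Measurable (H n)) → (∀ n w, |H n w| ≤ 1) → ∀ {k : ℕ},
    OrthogonalToPast P k H → ∀ b θ : ℕ → ℝ, (∀ n, |θ n| ≤ 1) →
    ∫ w, |∑ n ∈ Finset.range k, θ n * b n * H n w| ^ p ∂P ≤
      C * ∫ w, |∑ n ∈ Finset.range k, b n * H n w| ^ p ∂P := by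
  obtain ⟨r, rfl⟩ : ∃ r, p = 2 * r := ⟨p / 2, by ring⟩
  have hr : 1 / 2 < r := by linarith
  obtain ⟨L, K, hc⟩ := exists_burkholderConst hr
  have hK := hc.K_pos
  refine ⟨K * 3 ^ r, by positivity, ?_⟩
  intro Ω _ P _ H hHm hHb k hH b θ hθ
  have hmeas : ∀ (c : ℕ → ℝ), Measurable fun w => ∑ n ∈ Finset.range k, c n * H n w :=
    fun c => Finset.measurable_fun_sum _ fun n _ => (hHm n).const_mul (c n)
  have hint : ∀ (c : ℕ → ℝ), Integrable (fun w => |∑ n ∈ Finset.range k, c n * H n w| ^ (2 * r)) P :=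
    fun c => integrable_continuous_comp (Φ := fun z => |z.1| ^ (2 * r))
      (Continuous.rpow_const (by fun_prop) fun _ => Or.inr (by linarith)) (hmeas c) (hmeas c)
      (fun w => abs_sum_le_of_abs_le_one (fun n => hHb n w) k)
      (fun w => abs_sum_le_of_abs_le_one (fun n => hHb n w) k)
  have key : ∀ δ : ℝ, 0 < δ → ∫ w, |∑ n ∈ Finset.range k, θ n * b n * H n w| ^ (2 * r) ∂P -
      K * 3 ^ r * ∫ w, |∑ n ∈ Finset.range k, b n * H n w| ^ (2 * r) ∂P ≤
      (2 + K * 3 ^ r) * δ ^ r := by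
    intro δ hδ
    have h1 := integral_bfun_le (P := P) hr hc hδ hHm hHb hH b θ hθ
    have h2 : ∫ w, (|∑ n ∈ Finset.range k, θ n * b n * H n w| ^ (2 * r) -
        K * 3 ^ r * |∑ n ∈ Finset.range k, b n * H n w| ^ (2 * r) - K * 3 ^ r * δ ^ r) ∂P ≤
        ∫ w, bfun r L K δ (∑ n ∈ Finset.range k, b n * H n w)
          (∑ n ∈ Finset.range k, θ n * b n * H n w) ∂P := by
      refine integral_mono (((hint _).sub ((hint b).const_mul _)).sub (integrable_const _)) ?_
        fun w => abs_rpow_le_bfun hr hc hδ _ _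
      refine integrable_continuous_comp (continuous_bfun hc hδ)
        (M := max (∑ n ∈ Finset.range k, |b n|) (∑ n ∈ Finset.range k, |θ n * b n|))
        (hmeas b) (hmeas _)
        (fun w => (abs_sum_le_of_abs_le_one (fun n => hHb n w) k).trans (le_max_left _ _))
        (fun w => (abs_sum_le_of_abs_le_one (fun n => hHb n w) k).trans (le_max_right _ _))
    have hi : Integrable (fun w => |∑ n ∈ Finset.range k, θ n * b n * H n w| ^ (2 * r) -
        K * 3 ^ r * |∑ n ∈ Finset.range k, b n * H n w| ^ (2 * r)) P :=
      (hint _).sub ((hint b).const_mul _)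
    rw [integral_sub hi (integrable_const _),
      integral_sub (hint _) ((hint b).const_mul _), integral_const_mul] at h2
    simp only [integral_const, probReal_univ, smul_eq_mul, one_mul] at h2
    linarith
  -- The constants do not depend on `δ`, which served only for smoothness and can now tend to zero.
  have hlim : Tendsto (fun δ : ℝ => (2 + K * 3 ^ r) * δ ^ r) (𝓝[>] 0) (𝓝 0) := by
    have : ContinuousAt (fun δ : ℝ => (2 + K * 3 ^ r) * δ ^ r) 0 :=
      ContinuousAt.const_mul (Real.continuousAt_rpow_const _ _ (Or.inr (by linarith))) _
    have h0 := this.tendsto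
    rw [Real.zero_rpow (by linarith), mul_zero] at h0
    exact h0.mono_left nhdsWithin_le_nhds
  have := ge_of_tendsto hlim (eventually_nhdsWithin_of_forall fun δ hδ => key δ hδ)
  linarith

end Martingale

/-! ### Schauder decompositions and unconditional bases -/

section Decompositions

variable {E : Type*} [NormedAddCommGroup E] [NormedSpace ℝ E]

/-- Initial partial sums along `G` are bounded by `C` times later ones. -/
def HasPartialSumConst (G : ℕ → Submodule ℝ E) (C : ℝ) : Prop :=
  ∀ y : ℕ → E, (∀ n, y n ∈ G n) → ∀ k m, k ≤ m →
    ‖∑ n ∈ Finset.range k, y n‖ ≤ C * ‖∑ n ∈ Finset.range m, y n‖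

theorem HasPartialSumConst.norm_sum_le {G : ℕ → Submodule ℝ E} {C : ℝ}
    (hC : HasPartialSumConst G C) {y : ℕ → E} (hy : ∀ n, y n ∈ G n) {x : E}
    (hx : Tendsto (fun k => ∑ n ∈ Finset.range k, y n) atTop (𝓝 x)) (k : ℕ) :
    ‖∑ n ∈ Finset.range k, y n‖ ≤ C * ‖x‖ :=
  ge_of_tendsto (hx.norm.const_mul C) ((eventually_ge_atTop k).mono fun m hm => hC y hy k m hm)

theorem HasPartialSumConst.unique {G : ℕ → Submodule ℝ E} {C : ℝ}
    (hC : HasPartialSumConst G C) {y z : ℕ → E} (hy : ∀ n, y n ∈ G n) (hz : ∀ n, z n ∈ G n) {x : E}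
    (hyx : Tendsto (fun k => ∑ n ∈ Finset.range k, y n) atTop (𝓝 x))
    (hzx : Tendsto (fun k => ∑ n ∈ Finset.range k, z n) atTop (𝓝 x)) : y = z := by
  have hd : Tendsto (fun k => ∑ n ∈ Finset.range k, (y n - z n)) atTop (𝓝 0) := by
    simpa [Finset.sum_sub_distrib] using hyx.sub hzx
  have h0 : ∀ k, ∑ n ∈ Finset.range k, (y n - z n) = 0 := fun k => by
    have := hC.norm_sum_le (fun n => (G n).sub_mem (hy n) (hz n)) hd k
    rw [norm_zero, mul_zero] at this
    exact norm_le_zero_iff.1 this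
  funext n
  have h1 := h0 (n + 1)
  rw [Finset.sum_range_succ, h0 n, zero_add] at h1
  exact sub_eq_zero.1 h1

/-- Approximate `x` by finite sums `u j`. Their `k`-th partial sums are Cauchy in `j` uniformly in
`k`, so the limits in `j` and `k` may be interchanged; successive differences of the limit partial
sums are the terms, and closedness keeps them in `G n`. -/
theorem HasPartialSumConst.exists_expansion [CompleteSpace E] {G : ℕ → Submodule ℝ E} {C : ℝ}
    (hC : HasPartialSumConst G C) (hG : ∀ n, IsClosed (G n : Set E)) {x : E}
    (hx : x ∈ (⨆ n, G n).topologicalClosure) :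
    ∃ y : ℕ → E, (∀ n, y n ∈ G n) ∧
      Tendsto (fun k => ∑ n ∈ Finset.range k, y n) atTop (𝓝 x) := by
  obtain ⟨u, hu, hux⟩ := mem_closure_iff_seq_limit.1 hx
  have hexp : ∀ j, ∃ y : ℕ → E, (∀ n, y n ∈ G n) ∧
      Tendsto (fun k => ∑ n ∈ Finset.range k, y n) atTop (𝓝 (u j)) := fun j => by
    obtain ⟨f, hf, hfu⟩ := (Submodule.mem_iSup_iff_exists_finsupp _ _).1 (hu j)
    refine ⟨f, hf, ?_⟩
    rw [← hfu]
    exact (hasSum_sum_of_ne_finset_zero fun b hb => by simpa using hb).tendsto_sum_nat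
  choose y hy hyu using hexp
  have hS : ∀ i j k, ‖∑ n ∈ Finset.range k, y i n - ∑ n ∈ Finset.range k, y j n‖ ≤
      C * ‖u i - u j‖ := fun i j k => by
    rw [← Finset.sum_sub_distrib]
    refine hC.norm_sum_le (fun n => (G n).sub_mem (hy i n) (hy j n)) ?_ k
    simpa [Finset.sum_sub_distrib] using (hyu i).sub (hyu j)
  have hcauchy : ∀ k, CauchySeq fun j => ∑ n ∈ Finset.range k, y j n := fun k => by
    have hu' := hux.cauchySeq
    rw [cauchySeq_iff_tendsto_dist_atTop_0] at hu' ⊢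
    refine squeeze_zero (fun _ => dist_nonneg) (fun z => ?_) (by simpa using hu'.const_mul C)
    simpa only [dist_eq_norm] using hS z.1 z.2 k
  choose s hs using fun k => cauchySeq_tendsto_of_complete (hcauchy k)
  have hSs : ∀ j k, ‖∑ n ∈ Finset.range k, y j n - s k‖ ≤ C * ‖u j - x‖ := fun j k =>
    le_of_tendsto_of_tendsto' ((tendsto_const_nhds.sub (hs k)).norm)
      (((tendsto_const_nhds.sub hux).norm).const_mul C) fun i => hS j i k
  have hunif : TendstoUniformly (fun j k => ∑ n ∈ Finset.range k, y j n) s atTop := by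
    rw [Metric.tendstoUniformly_iff]
    intro ε hε
    have h0 : Tendsto (fun j => C * ‖u j - x‖) atTop (𝓝 0) := by
      simpa using ((hux.sub_const x).norm).const_mul C
    filter_upwards [h0.eventually (gt_mem_nhds hε)] with j hj k
    rw [dist_comm, dist_eq_norm]
    exact (hSs j k).trans_lt hj
  have hsx : Tendsto s atTop (𝓝 x) :=
    hunif.tendsto_of_eventually_tendsto (Eventually.of_forall fun j => hyu j) hux
  have hs0 : s 0 = 0 := tendsto_nhds_unique (hs 0) (by simp)
  refine ⟨fun n => s (n + 1) - s n, fun n => ?_, ?_⟩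
  · refine (hG n).mem_of_tendsto ((hs (n + 1)).sub (hs n)) (Eventually.of_forall fun j => ?_)
    simpa [Finset.sum_range_succ] using hy j n
  · simp_rw [Finset.sum_range_sub, hs0, sub_zero]
    exact hsx

theorem isSchauderDecomposition_of_partialSum [CompleteSpace E] {N : ℕ∞}
    {F : ℕ → Submodule ℝ E} {C : ℝ} (hF : ∀ n : ℕ, (n : ℕ∞) < N → IsClosed (F n : Set E))
    (hC : ∀ y : ℕ → E, (∀ n : ℕ, (n : ℕ∞) < N → y n ∈ F n) → (∀ n : ℕ, N ≤ n → y n = 0) →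
      ∀ k m, k ≤ m → ‖∑ n ∈ Finset.range k, y n‖ ≤ C * ‖∑ n ∈ Finset.range m, y n‖) :
    IsSchauderDecomposition N (⨆ (n : ℕ) (_ : (n : ℕ∞) < N), F n).topologicalClosure F := by
  refine ⟨fun n hn => ⟨(le_iSup₂ (f := fun (n : ℕ) (_ : (n : ℕ∞) < N) => F n) n hn).trans
    (Submodule.le_topologicalClosure _), hF n hn⟩, fun x hx => ?_⟩
  -- A decomposition of length `N` is padded by zero subspaces to an infinite one: `G n` is `F n`
  -- below `N` and `⊥` beyond.
  set G : ℕ → Submodule ℝ E := fun n => ⨆ (_ : (n : ℕ∞) < N), F n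
  have hlt : ∀ n : ℕ, (n : ℕ∞) < N → G n = F n := fun n hn => by simp [G, hn]
  have hge : ∀ n : ℕ, N ≤ n → G n = ⊥ := fun n hn => by simp [G, not_lt.2 hn]
  have hmem : ∀ y : ℕ → E, (∀ n, y n ∈ G n) ↔
      (∀ n : ℕ, (n : ℕ∞) < N → y n ∈ F n) ∧ (∀ n : ℕ, N ≤ n → y n = 0) := fun y => by
    constructor
    · exact fun h => ⟨fun n hn => hlt n hn ▸ h n, fun n hn => by
        have := h n; rwa [hge n hn, Submodule.mem_bot] at this⟩
    · rintro ⟨h1, h2⟩ n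
      rcases lt_or_ge (n : ℕ∞) N with hn | hn
      · rw [hlt n hn]; exact h1 n hn
      · rw [h2 n hn]; exact zero_mem _
  have hG : HasPartialSumConst G C := fun y hy => hC y ((hmem y).1 hy).1 ((hmem y).1 hy).2
  have hcl : ∀ n, IsClosed (G n : Set E) := fun n => by
    rcases lt_or_ge (n : ℕ∞) N with hn | hn
    · rw [hlt n hn]; exact hF n hn
    · rw [hge n hn]; simp
  obtain ⟨y, hy, hyx⟩ := hG.exists_expansion hcl hx
  refine ⟨y, ⟨((hmem y).1 hy).1, ((hmem y).1 hy).2, hyx⟩, fun z ⟨hz1, hz2, hzx⟩ => ?_⟩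
  exact hG.unique ((hmem z).2 ⟨hz1, hz2⟩) hy hzx hyx

/-- `C` is an unconditional constant of the sequence `(e n)_{n < N}`. -/
structure UnconditionalConst (N : ℕ∞) (e : ℕ → E) (C : ℝ) : Prop where
  one_le : 1 ≤ C
  norm_le : ∀ (k : ℕ) (a b : ℕ → ℝ), (∀ n, |a n| ≤ |b n|) → (∀ n : ℕ, N ≤ n → b n = 0) →
    ‖∑ n ∈ Finset.range k, a n • e n‖ ≤ C * ‖∑ n ∈ Finset.range k, b n • e n‖

/-- Replacing the coefficients beyond `k` by zero is a special case of domination, so an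
unconditional constant is also a partial sum constant. -/
theorem UnconditionalConst.norm_sum_range_le {N : ℕ∞} {e : ℕ → E} {C : ℝ}
    (h : UnconditionalConst N e C) {y : ℕ → E} {c : ℕ → ℝ} (hy : ∀ n, y n = c n • e n)
    (hc : ∀ n : ℕ, N ≤ n → c n = 0) {k m : ℕ} (hkm : k ≤ m) :
    ‖∑ n ∈ Finset.range k, y n‖ ≤ C * ‖∑ n ∈ Finset.range m, y n‖ := by
  have := h.norm_le m (fun n => if n < k then c n else 0) c
    (fun n => by split_ifs <;> simp) hc
  convert this using 2
  · simp only [ite_smul, zero_smul, ← Finset.sum_filter]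
    have : Finset.range k = {a ∈ Finset.range m | a < k} := by
      ext n; simp; omega
    rw [← this]
    simp only [hy]
  · simp [hy]

theorem UnconditionalConst.isUnconditionalBasis [CompleteSpace E] {N : ℕ∞} {e : ℕ → E} {C : ℝ}
    (h : UnconditionalConst N e C) (hne : ∀ n : ℕ, (n : ℕ∞) < N → e n ≠ 0) :
    IsUnconditionalBasis N (closedSpan N e) e := by
  have hdec := isSchauderDecomposition_of_partialSum (N := N) (F := fun n => ℝ ∙ e n) (C := C)
    (fun n _ => Submodule.closed_of_finiteDimensional _) (fun y h1 h2 k m hkm => by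
      have : ∀ n, ∃ c : ℝ, y n = c • e n ∧ (N ≤ n → c = 0) := fun n => by
        rcases lt_or_ge (n : ℕ∞) N with hn | hn
        · obtain ⟨c, hc⟩ := Submodule.mem_span_singleton.1 (h1 n hn)
          exact ⟨c, hc.symm, fun h => absurd hn (not_lt.2 h)⟩
        · exact ⟨0, by simp [h2 n hn], fun _ => rfl⟩
      choose c hc hc0 using this
      exact h.norm_sum_range_le hc (fun n hn => hc0 n hn) hkm)
  have hY : (⨆ (n : ℕ) (_ : (n : ℕ∞) < N), ℝ ∙ e n).topologicalClosure = closedSpan N e := by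
    unfold closedSpan
    congr 1
    rw [← Set.biUnion_of_singleton (e '' _), Set.biUnion_image, Submodule.span_iUnion₂]
    rfl
  rw [hY] at hdec
  refine ⟨⟨fun n hn => (hdec.1 n hn).1 (Submodule.mem_span_singleton_self _), fun x hx => ?_⟩,
    C, h.one_le, fun k hk a b hab => ?_⟩
  · obtain ⟨y, ⟨hy1, hy2, hyx⟩, huniq⟩ := hdec.2 x hx
    have : ∀ n, ∃ c : ℝ, y n = c • e n ∧ (N ≤ n → c = 0) := fun n => by
      rcases lt_or_ge (n : ℕ∞) N with hn | hn
      · obtain ⟨c, hc⟩ := Submodule.mem_span_singleton.1 (hy1 n hn)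
        exact ⟨c, hc.symm, fun h => absurd hn (not_lt.2 h)⟩
      · exact ⟨0, by simp [hy2 n hn], fun _ => rfl⟩
    choose c hc hc0 using this
    refine ⟨c, ⟨fun n hn => hc0 n hn, by simpa only [hc] using hyx⟩, fun d ⟨hd0, hdx⟩ => ?_⟩
    have := huniq (fun n => d n • e n) ⟨fun n _ => Submodule.smul_mem _ _
      (Submodule.mem_span_singleton_self _), fun n hn => by simp [hd0 n hn], hdx⟩
    funext n
    rcases lt_or_ge (n : ℕ∞) N with hn | hn
    · have h1 := congrFun this n
      simp only [hc] at h1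
      exact smul_left_injective ℝ (hne n hn) h1
    · rw [hd0 n hn, hc0 n hn]
  · have hlt : ∀ n ∈ Finset.range k, n < k := fun n => Finset.mem_range.1
    -- The coefficients are compared only below `k`, so both sequences are cut off there; `k ≤ N`
    -- ensures that the cut sequences vanish beyond `N`.
    have := h.norm_le k (fun n => if n < k then a n else 0) (fun n => if n < k then b n else 0)
      (fun n => by split_ifs with hn; exacts [hab n hn, le_rfl])
      (fun n hn => if_neg fun hnk => absurd ((Nat.cast_lt.2 hnk).trans_le hk) (not_lt.2 hn))
    rw [Finset.sum_congr rfl fun n hn => by rw [if_pos (hlt n hn)],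
      Finset.sum_congr (s₁ := Finset.range k) (f := fun n => (if n < k then b n else 0) • e n) rfl
        fun n hn => by rw [if_pos (hlt n hn)]] at this
    exact this

/-- Blocks of an unconditional sequence form unconditional sequences. -/
theorem UnconditionalConst.blocks {N M : ℕ∞} {e : ℕ → E} {C : ℝ}
    (h : UnconditionalConst N e C) {β : Type*} {σ ν : ℕ → β}
    (hν : Set.InjOn ν {n : ℕ | (n : ℕ∞) < M}) {y : ℕ → E}
    (hy : ∀ n : ℕ, (n : ℕ∞) < M →
      y n ∈ Submodule.span ℝ (e '' {j : ℕ | (j : ℕ∞) < N ∧ σ j = ν n})) :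
    UnconditionalConst M y C := by
  refine ⟨h.one_le, fun k a b hab hb => ?_⟩
  have hc : ∀ n : ℕ, ∃ c : ℕ →₀ ℝ, (∀ j, c j ≠ 0 → (j : ℕ∞) < N ∧ σ j = ν n ∧ (n : ℕ∞) < M) ∧
      ((n : ℕ∞) < M → Finsupp.linearCombination ℝ e c = y n) := fun n => by
    by_cases hn : (n : ℕ∞) < M
    · obtain ⟨c, hc, hcy⟩ := (Finsupp.mem_span_image_iff_linearCombination ℝ).1 (hy n hn)
      refine ⟨c, fun j hj => ?_, fun _ => hcy⟩
      have := (Finsupp.mem_supported ℝ c).1 hc (Finsupp.mem_support_iff.2 hj)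
      exact ⟨this.1, this.2, hn⟩
    · exact ⟨0, fun j hj => absurd rfl hj, fun h => absurd h hn⟩
  choose c hc hcy using hc
  obtain ⟨K, hK⟩ : ∃ K, ∀ n ∈ Finset.range k, (c n).support ⊆ Finset.range K := by
    obtain ⟨K, hK⟩ := ((Finset.range k).biUnion fun n => (c n).support).exists_nat_subset_range
    exact ⟨K, fun n hn => (Finset.subset_biUnion_of_mem (fun n => (c n).support) hn).trans hK⟩
  have hsum : ∀ a : ℕ → ℝ, (∀ n : ℕ, M ≤ n → a n = 0) → ∑ n ∈ Finset.range k, a n • y n =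
      ∑ j ∈ Finset.range K, (∑ n ∈ Finset.range k, a n * c n j) • e j := by
    intro a ha
    simp_rw [Finset.sum_smul]
    rw [Finset.sum_comm]
    refine Finset.sum_congr rfl fun n hn => ?_
    rcases lt_or_ge (n : ℕ∞) M with hM | hM
    · rw [← hcy n hM, Finsupp.linearCombination_apply,
        Finsupp.sum_of_support_subset _ (hK n hn) _ (by simp), Finset.smul_sum]
      exact Finset.sum_congr rfl fun j _ => by rw [mul_smul]
    · simp [ha n hM]
  have ha : ∀ n : ℕ, M ≤ n → a n = 0 := fun n hn => by
    have := hab n; rw [hb n hn, abs_zero] at this; exact abs_nonpos_iff.1 this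
  rw [hsum a ha, hsum b hb]
  refine h.norm_le K _ _ (fun j => ?_) fun j hj => Finset.sum_eq_zero fun n _ => ?_
  · by_cases hex : ∃ n ∈ Finset.range k, c n j ≠ 0
    · obtain ⟨n, hn, hnj⟩ := hex
      -- The index `j` belongs to one block only, as `σ j` determines `ν n` and `ν` is injective
      -- below `M`. Thus the coefficient of `e j` is a single product, and domination passes to it.
      have hz : ∀ m ∈ Finset.range k, m ≠ n → c m j = 0 := fun m _ hmn => by
        by_contra hmj
        exact hmn (hν (hc m j hmj).2.2 (hc n j hnj).2.2
          ((hc m j hmj).2.1.symm.trans (hc n j hnj).2.1))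
      rw [Finset.sum_eq_single_of_mem n hn fun m hm hmn => by rw [hz m hm hmn, mul_zero],
        Finset.sum_eq_single_of_mem n hn fun m hm hmn => by rw [hz m hm hmn, mul_zero],
        abs_mul, abs_mul]
      exact mul_le_mul_of_nonneg_right (hab n) (abs_nonneg _)
    · push Not at hex
      rw [Finset.sum_eq_zero fun n hn => by rw [hex n hn, mul_zero],
        Finset.sum_eq_zero fun n hn => by rw [hex n hn, mul_zero]]
  · by_contra hne
    exact absurd (hc n j (right_ne_zero_of_mul hne)).1 (not_lt.2 hj)

/-- Vectors picked from the `F n` are blocks of `e` and inherit the constant `C`. With coefficients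
`1` this bounds partial sums and gives the decomposition; with arbitrary coefficients it gives
unconditionality. -/
theorem UnconditionalConst.isUnconditionalFDD [CompleteSpace E] {N M : ℕ∞} {e : ℕ → E} {C : ℝ}
    (h : UnconditionalConst N e C) {β : Type*} {σ ν : ℕ → β}
    (hν : Set.InjOn ν {n : ℕ | (n : ℕ∞) < M})
    (hcov : ∀ j : ℕ, (j : ℕ∞) < N → ∃ n : ℕ, (n : ℕ∞) < M ∧ σ j = ν n)
    {F : ℕ → Submodule ℝ E}
    (hF : ∀ n : ℕ, (n : ℕ∞) < M →
      F n = Submodule.span ℝ (e '' {j : ℕ | (j : ℕ∞) < N ∧ σ j = ν n}))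
    (hfin : ∀ n : ℕ, (n : ℕ∞) < M → FiniteDimensional ℝ (F n)) :
    IsUnconditionalFDD M (closedSpan N e) F := by
  have hY : (⨆ (n : ℕ) (_ : (n : ℕ∞) < M), F n).topologicalClosure = closedSpan N e := by
    unfold closedSpan
    congr 1
    apply le_antisymm
    · refine iSup₂_le fun n hn => ?_
      rw [hF n hn]
      exact Submodule.span_mono (Set.image_mono fun j hj => hj.1)
    · rw [Submodule.span_le]
      rintro _ ⟨j, hj, rfl⟩
      obtain ⟨n, hn, hjn⟩ := hcov j hj
      refine (le_iSup₂_of_le n hn le_rfl : F n ≤ ⨆ (n : ℕ) (_ : (n : ℕ∞) < M), F n) ?_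
      rw [hF n hn]
      exact Submodule.subset_span ⟨j, ⟨hj, hjn⟩, rfl⟩
  have hb : ∀ y : ℕ → E, (∀ n : ℕ, (n : ℕ∞) < M → y n ∈ F n) → UnconditionalConst M y C :=
    fun y hy => h.blocks hν fun n hn => hF n hn ▸ hy n hn
  refine ⟨?_, hfin, fun x hx => (hb x fun n hn => (hx n hn).1).isUnconditionalBasis
    fun n hn => (hx n hn).2⟩
  rw [← hY]
  refine isSchauderDecomposition_of_partialSum (C := C) (fun n hn => ?_) fun y h1 h2 k m hkm => ?_
  · have := hfin n hn
    exact Submodule.closed_of_finiteDimensional _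
  · refine (hb y h1).norm_sum_range_le (c := fun n => if (n : ℕ∞) < M then 1 else 0)
      (fun n => ?_) (fun n hn => if_neg (not_lt.2 hn)) hkm
    split_ifs with hn
    · simp
    · simp [h2 n (not_lt.1 hn)]

end Decompositions

section

/-! ### Dyadic intervals -/

namespace Dyadic

theorem left_nonneg (I : Dyadic) : 0 ≤ I.left := by unfold left; positivity

theorem right_le_one (I : Dyadic) : I.right ≤ 1 := by
  unfold right
  rw [div_le_one (by positivity)]
  have := I.idx_lt
  exact_mod_cast this

theorem right_sub_left (I : Dyadic) : I.right - I.left = (1 / 2) ^ I.level := by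
  unfold left right
  rw [← sub_div, add_sub_cancel_left, one_div_pow]

theorem toSet_subset (I : Dyadic) : I.toSet ⊆ Set.Ico 0 1 :=
  Set.Ico_subset_Ico I.left_nonneg I.right_le_one

theorem measurableSet_toSet (I : Dyadic) : MeasurableSet I.toSet := measurableSet_Ico

/-- All endpoints involved are integer multiples of `2^(-J.level)`, so no endpoint of `I` lies
strictly inside `J`. -/
theorem subset_or_disjoint {I J : Dyadic} (h : I.level ≤ J.level) :
    J.toSet ⊆ I.toSet ∨ Disjoint I.toSet J.toSet := by
  obtain ⟨k, hk⟩ := Nat.exists_eq_add_of_le h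
  have hl : I.left = (I.idx * 2 ^ k : ℕ) / 2 ^ J.level := by
    unfold left; rw [hk, pow_add]; push_cast; field_simp
  have hr : I.right = ((I.idx + 1) * 2 ^ k : ℕ) / 2 ^ J.level := by
    unfold right; rw [hk, pow_add]; push_cast; field_simp
  have h2 : (0 : ℝ) < 2 ^ J.level := by positivity
  have hjr : J.right = (J.idx + 1 : ℕ) / 2 ^ J.level := by unfold right; push_cast; rfl
  have hmono : ∀ {a b : ℕ}, a ≤ b → (a : ℝ) / 2 ^ J.level ≤ b / 2 ^ J.level := fun hab => by
    gcongr
  by_cases h1 : I.idx * 2 ^ k ≤ J.idx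
  · by_cases h3 : J.idx + 1 ≤ (I.idx + 1) * 2 ^ k
    · left
      refine Set.Ico_subset_Ico ?_ ?_
      · rw [hl]; exact hmono h1
      · rw [hr, hjr]; exact hmono h3
    · right
      refine Set.disjoint_left.2 fun t ht ht' => ?_
      have : I.right ≤ J.left := by rw [hr]; exact hmono (by omega)
      exact absurd (ht.2.trans_le this) (not_lt.2 ht'.1)
  · right
    refine Set.disjoint_left.2 fun t ht ht' => ?_
    have : J.right ≤ I.left := by rw [hl, hjr]; exact hmono (by omega)
    exact absurd (ht'.2.trans_le this) (not_lt.2 ht.1)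

theorem disjoint_of_level_eq {I J : Dyadic} (h : I.level = J.level) (hne : I ≠ J) :
    Disjoint I.toSet J.toSet := by
  have hidx : I.idx ≠ J.idx := fun h' => hne (Dyadic.ext h h')
  have h2 : (0 : ℝ) < 2 ^ J.level := by positivity
  have key : ∀ {a b : ℕ}, a < b → ((a : ℝ) + 1) / 2 ^ J.level ≤ b / 2 ^ J.level := fun hab => by
    gcongr; exact_mod_cast hab
  refine Set.disjoint_left.2 fun t ht ht' => ?_
  unfold toSet left right at ht ht'
  rw [h] at ht
  rcases lt_or_gt_of_ne hidx with hlt | hlt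
  · exact absurd (ht.2.trans_le (key hlt)) (not_lt.2 ht'.1)
  · exact absurd (ht'.2.trans_le (key hlt)) (not_lt.2 ht.1)

theorem plus_right (I : Dyadic) : I.plus.right = I.minus.left := by
  simp [plus, minus, left, right]

theorem plus_left (I : Dyadic) : I.plus.left = I.left := by
  simp only [plus, left]; push_cast; rw [pow_succ]; field_simp

theorem minus_right (I : Dyadic) : I.minus.right = I.right := by
  simp only [minus, right]; push_cast; rw [pow_succ]; field_simp; ring

theorem plus_union_minus (I : Dyadic) : I.plus.toSet ∪ I.minus.toSet = I.toSet := by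
  unfold toSet
  rw [← plus_left I, ← minus_right I, plus_right I]
  refine Set.Ico_union_Ico_eq_Ico ?_ I.minus.left_lt_right.le
  rw [← plus_right]; exact I.plus.left_lt_right.le

theorem disjoint_plus_minus (I : Dyadic) : Disjoint I.plus.toSet I.minus.toSet :=
  disjoint_of_level_eq rfl fun h => by
    have := congrArg Dyadic.idx h
    simp [plus, minus] at this

theorem unitMeasure_toSet (I : Dyadic) :
    unitMeasure I.toSet = ENNReal.ofReal ((1 / 2) ^ I.level) := by
  rw [unitMeasure, Measure.restrict_apply I.measurableSet_toSet,
    Set.inter_eq_left.2 (I.toSet_subset.trans Set.Ico_subset_Icc_self), toSet, Real.volume_Ico,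
    right_sub_left]

theorem lt_of_lexLT {I J : Dyadic} (h : I.LexLT J) :
    I.level < J.level ∨ I.level = J.level ∧ I ≠ J :=
  h.imp_right fun h => ⟨h.1, fun he => by simp [he] at h⟩

/-- The Haar function as an honest function. -/
def haarFun (I : Dyadic) (t : ℝ) : ℝ :=
  I.plus.toSet.indicator (fun _ => 1) t - I.minus.toSet.indicator (fun _ => 1) t

theorem abs_haarFun_le (I : Dyadic) (t : ℝ) : |I.haarFun t| ≤ 1 := by
  unfold haarFun
  by_cases h1 : t ∈ I.plus.toSet <;> by_cases h2 : t ∈ I.minus.toSet <;> simp [h1, h2]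

theorem haarFun_of_notMem {I : Dyadic} {t : ℝ} (h : t ∉ I.toSet) : I.haarFun t = 0 := by
  rw [← plus_union_minus, Set.mem_union, not_or] at h
  simp [haarFun, h.1, h.2]

theorem indicator_const_on {I J : Dyadic} (h : I.level ≤ J.level) :
    ∃ c : ℝ, ∀ t ∈ J.toSet, I.toSet.indicator (fun _ => (1 : ℝ)) t = c := by
  rcases subset_or_disjoint h with h | h
  · exact ⟨1, fun t ht => Set.indicator_of_mem (h ht) _⟩
  · exact ⟨0, fun t ht => Set.indicator_of_notMem (Set.disjoint_right.1 h ht) _⟩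

theorem haarFun_const_on {I J : Dyadic} (h : I.level < J.level) :
    ∃ c : ℝ, ∀ t ∈ J.toSet, I.haarFun t = c := by
  obtain ⟨c, hc⟩ := indicator_const_on (I := I.plus) (J := J) h
  obtain ⟨d, hd⟩ := indicator_const_on (I := I.minus) (J := J) h
  exact ⟨c - d, fun t ht => by rw [haarFun, hc t ht, hd t ht]⟩

/-- At a coarser level each half of `I` contains or misses `J`; at equal level the supports are
disjoint. -/
theorem haarFun_const_on_of_lexLT {I J : Dyadic} (h : I.LexLT J) :
    ∃ c : ℝ, ∀ t ∈ J.toSet, I.haarFun t = c := by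
  rcases lt_of_lexLT h with h | ⟨h, hne⟩
  · exact haarFun_const_on h
  · exact ⟨0, fun t ht => haarFun_of_notMem
      (Set.disjoint_right.1 (disjoint_of_level_eq h hne) ht)⟩

/-! ### Haar functions as elements of `L_p`. -/

variable {p : ℝ≥0∞}

theorem coeFn_char (I : Dyadic) :
    (I.char p : ℝ → ℝ) =ᵐ[unitMeasure] I.toSet.indicator fun _ => 1 :=
  indicatorConstLp_coeFn

theorem coeFn_haar (I : Dyadic) : (I.haar p : ℝ → ℝ) =ᵐ[unitMeasure] I.haarFun := by
  filter_upwards [Lp.coeFn_sub (I.plus.char p) (I.minus.char p), I.plus.coeFn_char (p := p),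
    I.minus.coeFn_char (p := p)] with t h1 h2 h3
  rw [haar, h1, Pi.sub_apply, h2, h3, haarFun]

theorem integral_char (I : Dyadic) : ∫ t, I.char p t ∂unitMeasure = (1 / 2) ^ I.level := by
  rw [integral_congr_ae I.coeFn_char, integral_indicator_const _ I.measurableSet_toSet,
    Measure.real, unitMeasure_toSet, ENNReal.toReal_ofReal (by positivity)]
  simp

theorem integral_haar [Fact (1 ≤ p)] (I : Dyadic) : ∫ t, I.haar p t ∂unitMeasure = 0 := by
  rw [haar, integral_congr_ae (Lp.coeFn_sub _ _)]
  simp only [Pi.sub_apply]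
  rw [integral_sub ((Lp.memLp _).integrable Fact.out) ((Lp.memLp _).integrable Fact.out),
    integral_char, integral_char]
  simp [plus, minus]

theorem integral_haarFun (I : Dyadic) : ∫ t, I.haarFun t ∂unitMeasure = 0 := by
  have : Fact ((1 : ℝ≥0∞) ≤ 1) := ⟨le_rfl⟩
  rw [← integral_congr_ae (I.coeFn_haar (p := 1)), integral_haar]

theorem char_eq_plus_add_minus (I : Dyadic) : I.char p = I.plus.char p + I.minus.char p := by
  apply Lp.ext
  filter_upwards [Lp.coeFn_add (I.plus.char p) (I.minus.char p), I.plus.coeFn_char (p := p),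
    I.minus.coeFn_char (p := p), I.coeFn_char (p := p)] with t h1 h2 h3 h4
  rw [h1, Pi.add_apply, h2, h3, h4, ← plus_union_minus,
    Set.indicator_union_of_disjoint I.disjoint_plus_minus]

theorem eq_plus_or_minus {I : Dyadic} {n : ℕ} (h : I.level = n + 1) :
    ∃ J : Dyadic, J.level = n ∧ (I = J.plus ∨ I = J.minus) := by
  have hlt := I.idx_lt
  rw [h, pow_succ] at hlt
  refine ⟨⟨n, I.idx / 2, by omega⟩, rfl, ?_⟩
  rcases Nat.mod_two_eq_zero_or_one I.idx with h0 | h0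
  · left; ext
    · simp [plus, h]
    · simp [plus]; omega
  · right; ext
    · simp [minus, h]
    · simp [minus]; omega

/-- The whole interval `[0,1)`. -/
def unit : Dyadic := ⟨0, 0, by norm_num⟩

theorem eq_unit {I : Dyadic} (h : I.level = 0) : I = unit := by
  have := I.idx_lt
  ext
  · exact h
  · rw [h] at this; simp [unit]; omega

theorem char_mem_span_of_le (I : Dyadic) (n : ℕ) (h : I.level ≤ n) :
    I.char p ∈ Submodule.span ℝ (char p '' {J : Dyadic | J.level = n}) := by
  obtain ⟨k, hk⟩ := Nat.exists_eq_add_of_le h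
  induction k generalizing I with
  | zero => exact Submodule.subset_span ⟨I, by simpa using hk.symm, rfl⟩
  | succ k ih =>
    rw [char_eq_plus_add_minus]
    exact add_mem (ih I.plus (by simp [plus]; omega) (by simp [plus]; omega))
      (ih I.minus (by simp [minus]; omega) (by simp [minus]; omega))

theorem finite_level (n : ℕ) : {I : Dyadic | I.level = n}.Finite := by
  refine Set.Finite.of_finite_image (f := Dyadic.idx)
    ((Set.finite_lt_nat (2 ^ n)).subset ?_) fun I hI J hJ h => Dyadic.ext (hI.trans hJ.symm) h
  rintro _ ⟨I, hI, rfl⟩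
  have := I.idx_lt
  rw [Set.mem_ofPred_eq] at hI
  rwa [hI] at this

theorem finite_level_lt (n : ℕ) : {I : Dyadic | I.level < n}.Finite := by
  refine ((Set.finite_lt_nat n).biUnion fun k _ => finite_level k).subset fun I hI => ?_
  simp only [Set.mem_iUnion, Set.mem_ofPred_eq]
  exact ⟨I.level, hI, rfl⟩

theorem haar_mem_dyadicMeanZero [Fact (1 ≤ p)] {I : Dyadic} {n : ℕ} (h : I.level < n) :
    I.haar p ∈ dyadicMeanZero p n :=
  ⟨sub_mem (char_mem_span_of_le _ n h) (char_mem_span_of_le _ n h), integral_haar I⟩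

/-- Refinement by one level costs only Haar functions: the indicators of the halves of `J` are `(χ_J
± h_J) / 2`. -/
theorem span_char_le (n : ℕ) : Submodule.span ℝ (char p '' {I : Dyadic | I.level = n}) ≤
    (ℝ ∙ unit.char p) ⊔ Submodule.span ℝ (haar p '' {I : Dyadic | I.level < n}) := by
  induction n with
  | zero =>
    rw [Submodule.span_le]
    rintro _ ⟨I, hI, rfl⟩
    rw [eq_unit hI]
    exact Submodule.mem_sup_left (Submodule.mem_span_singleton_self _)
  | succ n ih =>
    rw [Submodule.span_le]
    rintro _ ⟨I, hI, rfl⟩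
    obtain ⟨J, hJ, h⟩ := eq_plus_or_minus hI
    have hsub : Submodule.span ℝ (haar p '' {I : Dyadic | I.level < n}) ≤
        Submodule.span ℝ (haar p '' {I : Dyadic | I.level < n + 1}) := by
      refine Submodule.span_mono (Set.image_mono fun I hI => ?_)
      rw [Set.mem_ofPred_eq] at hI ⊢
      omega
    have h1 : J.char p ∈ (ℝ ∙ unit.char p) ⊔
        Submodule.span ℝ (haar p '' {I : Dyadic | I.level < n + 1}) :=
      sup_le_sup_left hsub _ (ih (Submodule.subset_span ⟨J, hJ, rfl⟩))
    have h2 : J.haar p ∈ (ℝ ∙ unit.char p) ⊔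
        Submodule.span ℝ (haar p '' {I : Dyadic | I.level < n + 1}) :=
      Submodule.mem_sup_right (Submodule.subset_span ⟨J, Nat.lt_succ_of_le hJ.le, rfl⟩)
    have e1 : J.plus.char p = (1 / 2 : ℝ) • (J.char p + J.haar p) := by
      rw [char_eq_plus_add_minus J, haar]; module
    have e2 : J.minus.char p = (1 / 2 : ℝ) • (J.char p - J.haar p) := by
      rw [char_eq_plus_add_minus J, haar]; module
    rcases h with rfl | rfl
    · rw [SetLike.mem_coe, e1]; exact Submodule.smul_mem _ _ (add_mem h1 h2)
    · rw [SetLike.mem_coe, e2]; exact Submodule.smul_mem _ _ (sub_mem h1 h2)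

end Dyadic

variable {p : ℝ≥0∞}

/-- Step functions are constants plus Haar functions, and mean zero kills the constant. This
exhibits $X_\lambda$ as the span of the $h^\lambda_I$. -/
theorem dyadicMeanZero_eq_span [Fact (1 ≤ p)] (n : ℕ) :
    dyadicMeanZero p n = Submodule.span ℝ (Dyadic.haar p '' {I : Dyadic | I.level < n}) := by
  apply le_antisymm
  · rintro f ⟨hf, hf0⟩
    obtain ⟨c, hc, g, hg, rfl⟩ := Submodule.mem_sup.1 (Dyadic.span_char_le n hf)
    obtain ⟨a, rfl⟩ := Submodule.mem_span_singleton.1 hc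
    have hg0 : g ∈ meanZero p := by
      refine Submodule.span_le.2 ?_ hg
      rintro _ ⟨I, _, rfl⟩
      exact Dyadic.integral_haar I
    have h1 : a • Dyadic.unit.char p ∈ meanZero p := by
      have := sub_mem hf0 hg0
      rwa [add_sub_cancel_right] at this
    have h2 : a = 0 := by
      have h1' : ∫ t, (a • Dyadic.unit.char p : LpI p) t ∂unitMeasure = 0 := h1
      rw [integral_congr_ae (Lp.coeFn_smul _ _)] at h1'
      simp only [Pi.smul_apply, integral_smul, Dyadic.integral_char] at h1'
      simpa [Dyadic.unit] using h1'
    simpa [h2] using hg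
  · rw [Submodule.span_le]
    rintro _ ⟨I, hI, rfl⟩
    exact Dyadic.haar_mem_dyadicMeanZero hI

/-! ### The compressions -/

/-- For `[a, b) ⊆ [0, 1]` the bound `map_rescale_le` is an equality; exact formulas for integrals
and norms of compressions follow. -/
theorem map_rescale {a b : ℝ} (ha : 0 ≤ a) (hab : a < b) (hb : b ≤ 1) :
    Measure.map (fun t : ℝ => (t - a) / (b - a)) (unitMeasure.restrict (Set.Ico a b)) =
      ENNReal.ofReal (b - a) • unitMeasure := by
  have hc : 0 < b - a := sub_pos.2 hab
  have hvol : Measure.map (fun t : ℝ => (t - a) / (b - a)) volume =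
      ENNReal.ofReal (b - a) • (volume : Measure ℝ) := by
    have h1 : (fun t : ℝ => (t - a) / (b - a)) =
        (fun t : ℝ => t * (b - a)⁻¹) ∘ fun t : ℝ => t - a := by
      funext t; simp [div_eq_mul_inv]
    rw [h1, ← Measure.map_map (by fun_prop) (by fun_prop),
      (measurePreserving_sub_right volume a).map_eq,
      Real.map_volume_mul_right (inv_ne_zero hc.ne'), inv_inv, abs_of_pos hc]
  have hpre : (fun t : ℝ => (t - a) / (b - a)) ⁻¹' Set.Ico 0 1 = Set.Ico a b := by
    ext t
    simp only [Set.mem_preimage, Set.mem_Ico, le_div_iff₀ hc, div_lt_iff₀ hc]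
    constructor <;> rintro ⟨h, h'⟩ <;> constructor <;> linarith
  rw [unitMeasure, Measure.restrict_restrict measurableSet_Ico, Set.inter_eq_left.2
    ((Set.Ico_subset_Ico ha hb).trans Set.Ico_subset_Icc_self), ← hpre,
    ← Measure.restrict_map (measurable_rescale a b) measurableSet_Ico, hvol,
    Measure.restrict_smul, restrict_Ico_eq_restrict_Icc]

theorem coeFn_compress {a b : ℝ} (hab : a < b) (f : LpI p) :
    (compress p a b hab f : ℝ → ℝ) =ᵐ[unitMeasure] compressFun a b f :=
  (memLp_compressFun hab f).coeFn_toLp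

theorem setIntegral_rescale {a b : ℝ} (ha : 0 ≤ a) (hab : a < b) (hb : b ≤ 1) {F : ℝ → ℝ}
    (hF : AEStronglyMeasurable F unitMeasure) :
    ∫ t in Set.Ico a b, F ((t - a) / (b - a)) ∂unitMeasure = (b - a) * ∫ t, F t ∂unitMeasure := by
  have h := map_rescale ha hab hb
  rw [← integral_map (f := F) (measurable_rescale a b).aemeasurable, h, integral_smul_measure,
    ENNReal.toReal_ofReal (sub_pos.2 hab).le, smul_eq_mul]
  rw [h]
  exact hF.smul_measure _

theorem norm_compress [Fact (1 ≤ p)] (hp : p ≠ ∞) {a b : ℝ} (ha : 0 ≤ a) (hab : a < b) (hb : b ≤ 1)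
    (f : LpI p) : ‖compress p a b hab f‖ = (b - a) ^ (1 / p.toReal) * ‖f‖ := by
  have hc : 0 < b - a := sub_pos.2 hab
  have h := map_rescale ha hab hb
  rw [Lp.norm_def, eLpNorm_congr_ae (coeFn_compress hab f), compressFun,
    eLpNorm_indicator_eq_eLpNorm_restrict measurableSet_Ico,
    show (fun t => f ((t - a) / (b - a))) = f ∘ (fun t => (t - a) / (b - a)) from rfl,
    ← eLpNorm_map_measure (by rw [h]; exact (Lp.aestronglyMeasurable f).smul_measure _)
      (measurable_rescale a b).aemeasurable, h, eLpNorm_smul_measure_of_ne_top hp,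
    smul_eq_mul, ENNReal.toReal_mul, ← Lp.norm_def, ENNReal.ofReal_rpow_of_pos hc,
    ENNReal.toReal_ofReal (by positivity)]
  simp

theorem continuous_compress [Fact (1 ≤ p)] (hp : p ≠ ∞) {a b : ℝ} (ha : 0 ≤ a) (hab : a < b)
    (hb : b ≤ 1) : Continuous (compress p a b hab) :=
  AddMonoidHomClass.continuous_of_bound _ _ fun f => (norm_compress hp ha hab hb f).le

theorem integral_compress {a b : ℝ} (ha : 0 ≤ a) (hab : a < b) (hb : b ≤ 1) (f : LpI p) :
    ∫ t, compress p a b hab f t ∂unitMeasure = (b - a) * ∫ t, f t ∂unitMeasure := by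
  rw [integral_congr_ae (coeFn_compress hab f), compressFun, integral_indicator measurableSet_Ico,
    setIntegral_rescale ha hab hb (Lp.aestronglyMeasurable f)]

theorem compressFun_compressFun {a b c d : ℝ} (ha : 0 ≤ a) (hb : b ≤ 1)
    (hcd : c < d) (f : ℝ → ℝ) :
    compressFun c d (compressFun a b f) =
      compressFun (c + (d - c) * a) (c + (d - c) * b) f := by
  have h0 : 0 < d - c := sub_pos.2 hcd
  funext t
  unfold compressFun
  have hiff : (t ∈ Set.Ico c d ∧ (t - c) / (d - c) ∈ Set.Ico a b) ↔
      t ∈ Set.Ico (c + (d - c) * a) (c + (d - c) * b) := by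
    simp only [Set.mem_Ico, le_div_iff₀ h0, div_lt_iff₀ h0]
    constructor
    · rintro ⟨⟨_, _⟩, _, _⟩; constructor <;> linarith
    · rintro ⟨h1, h2⟩
      have : 0 ≤ (d - c) * a := by positivity
      have : (d - c) * b ≤ (d - c) * 1 := by gcongr
      refine ⟨⟨?_, ?_⟩, ?_, ?_⟩ <;> linarith
  by_cases h : t ∈ Set.Ico (c + (d - c) * a) (c + (d - c) * b)
  · obtain ⟨h1, h2⟩ := hiff.2 h
    rw [Set.indicator_of_mem h, Set.indicator_of_mem h1, Set.indicator_of_mem h2]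
    congr 1
    have h3 : c + (d - c) * b - (c + (d - c) * a) = (d - c) * (b - a) := by ring
    rw [h3, div_sub' h0.ne', div_div]
    congr 1
    ring
  · rw [Set.indicator_of_notMem h]
    by_cases h1 : t ∈ Set.Ico c d
    · rw [Set.indicator_of_mem h1, Set.indicator_of_notMem fun h2 => h (hiff.1 ⟨h1, h2⟩)]
    · rw [Set.indicator_of_notMem h1]

/-! ### Compressions to dyadic intervals. -/

namespace Dyadic

theorem coeFn_T (J : Dyadic) (f : LpI p) :
    (J.T p f : ℝ → ℝ) =ᵐ[unitMeasure] compressFun J.left J.right f :=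
  coeFn_compress _ f

theorem norm_T [Fact (1 ≤ p)] (hp : p ≠ ∞) (J : Dyadic) (f : LpI p) :
    ‖J.T p f‖ = (J.right - J.left) ^ (1 / p.toReal) * ‖f‖ :=
  norm_compress hp J.left_nonneg _ J.right_le_one f

theorem continuous_T [Fact (1 ≤ p)] (hp : p ≠ ∞) (J : Dyadic) : Continuous (J.T p) :=
  continuous_compress hp J.left_nonneg _ J.right_le_one

theorem T_injective [Fact (1 ≤ p)] (hp : p ≠ ∞) (J : Dyadic) : Function.Injective (J.T p) := by
  rw [← LinearMap.ker_eq_bot, LinearMap.ker_eq_bot']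
  intro f hf
  have h := norm_T hp J f
  rw [hf, norm_zero, eq_comm, mul_eq_zero] at h
  rcases h with h | h
  · have : 0 < (J.right - J.left) ^ (1 / p.toReal) := 
      Real.rpow_pos_of_pos (sub_pos.2 J.left_lt_right) _
    exact absurd h this.ne'
  · exact norm_eq_zero.1 h

theorem T_mem_meanZero [Fact (1 ≤ p)] (J : Dyadic) {f : LpI p} (hf : f ∈ meanZero p) :
    J.T p f ∈ meanZero p := by
  change ∫ t, J.T p f t ∂unitMeasure = 0
  rw [T, integral_compress J.left_nonneg _ J.right_le_one,
    show ∫ t, f t ∂unitMeasure = 0 from hf, mul_zero]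

theorem T_const (J : Dyadic) (c : ℝ) : J.T p (Lp.const p unitMeasure c) = c • J.char p := by
  apply Lp.ext
  filter_upwards [J.coeFn_T (Lp.const p unitMeasure c), Lp.coeFn_smul c (J.char p),
    J.coeFn_char (p := p), compressFun_congr J.left_lt_right (Lp.coeFn_const p unitMeasure c)]
    with t h1 h2 h3 h4
  rw [h1, h2, h4, Pi.smul_apply, h3, compressFun, toSet]
  by_cases ht : t ∈ Set.Ico J.left J.right <;> simp [ht]

theorem T_unit (f : LpI p) : unit.T p f = f := by
  apply Lp.ext
  have h01 : ∀ᵐ t ∂unitMeasure, t ∈ Set.Ico (0 : ℝ) 1 := by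
    rw [unitMeasure, ← restrict_Ico_eq_restrict_Icc]
    exact ae_restrict_mem measurableSet_Ico
  filter_upwards [unit.coeFn_T f, h01] with t h1 h2
  rw [h1, compressFun]
  have e1 : unit.left = 0 := by simp [unit, left]
  have e2 : unit.right = 1 := by simp [unit, right]
  rw [e1, e2, Set.indicator_of_mem h2]
  simp

/-- The copy of `J` in the left half of the unit interval. -/
def inLeft (J : Dyadic) : Dyadic :=
  ⟨J.level + 1, J.idx, by have := J.idx_lt; rw [pow_succ]; omega⟩

/-- The copy of `J` in the right half of the unit interval. -/
def inRight (J : Dyadic) : Dyadic :=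
  ⟨J.level + 1, 2 ^ J.level + J.idx, by have := J.idx_lt; rw [pow_succ]; omega⟩

/-- The recursion for `R` halves from outside, prepending a binary digit to the position of an
interval, whereas `plus` and `minus` append one. This composition rule matches iterated halving with
the operators `T_J` used by the trees. -/
theorem compress_T {c d : ℝ} (hcd : c < d) (J K : Dyadic) (h1 : K.left = c + (d - c) * J.left)
    (h2 : K.right = c + (d - c) * J.right) (f : LpI p) :
    compress p c d hcd (J.T p f) = K.T p f := by
  apply Lp.ext
  filter_upwards [coeFn_compress hcd (J.T p f), K.coeFn_T f,
    compressFun_congr hcd (J.coeFn_T f)] with t e1 e2 e3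
  rw [e1, e2, e3, compressFun_compressFun J.left_nonneg J.right_le_one hcd, h1, h2]

theorem compress_left_T (J : Dyadic) (f : LpI p) :
    compress p 0 (1 / 2) (by norm_num) (J.T p f) = J.inLeft.T p f :=
  compress_T _ _ _ (by simp [inLeft, left, pow_succ]; field_simp)
    (by simp [inLeft, right, pow_succ]; field_simp) f

theorem compress_right_T (J : Dyadic) (f : LpI p) :
    compress p (1 / 2) 1 (by norm_num) (J.T p f) = J.inRight.T p f :=
  compress_T _ _ _ (by simp [inRight, left, pow_succ]; field_simp; ring)
    (by simp [inRight, right, pow_succ]; field_simp; ring) f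

theorem eq_inLeft_or_inRight {I : Dyadic} {n : ℕ} (h : I.level = n + 1) :
    ∃ J : Dyadic, J.level = n ∧ (I = J.inLeft ∨ I = J.inRight) := by
  have hlt := I.idx_lt
  rw [h, pow_succ] at hlt
  by_cases hi : I.idx < 2 ^ n
  · exact ⟨⟨n, I.idx, hi⟩, rfl, Or.inl (Dyadic.ext h rfl)⟩
  · refine ⟨⟨n, I.idx - 2 ^ n, by omega⟩, rfl, Or.inr (Dyadic.ext h ?_)⟩
    simp [inRight]; omega

end Dyadic

end

section

/-! ### Distributional embeddings -/

variable {p : ℝ≥0∞}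

theorem measurable_coe (f : LpI p) : Measurable (f : ℝ → ℝ) := (Lp.stronglyMeasurable f).measurable

theorem measurable_coe_pi {ι : Type*} (u : ι → LpI p) : Measurable fun t i => u i t :=
  measurable_pi_lambda _ fun i => measurable_coe (u i)

theorem coeFn_dual_apply {ι : Type*} [Fintype ι] [DecidableEq ι] (L : StrongDual ℝ (ι → ℝ))
    (u : ι → LpI p) :
    (fun t => L fun i => u i t) =ᵐ[unitMeasure] (∑ i, L (Pi.single i 1) • u i : LpI p) := by
  have h : ∀ᵐ t ∂unitMeasure, ∀ i, (L (Pi.single i 1) • u i : LpI p) t =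
      L (Pi.single i 1) * u i t := by
    rw [ae_all_iff]
    intro i
    filter_upwards [Lp.coeFn_smul (L (Pi.single i 1)) (u i)] with t ht
    rw [ht]; rfl
  filter_upwards [h, Lp.coeFn_fun_finsetSum Finset.univ fun i => L (Pi.single i 1) • u i]
    with t h1 h2
  rw [h2]
  simp_rw [h1]
  conv_lhs => rw [pi_eq_sum_univ' fun i => u i t]
  rw [map_sum]
  refine Finset.sum_congr rfl fun i _ => ?_
  rw [map_smul, smul_eq_mul, mul_comm]

/-- The Cramér–Wold device: the law of a vector is determined by its linear combinations, and these
are again elements of `L_p`, to which linear operators can be applied. -/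
theorem charFunDual_map_coe {ι : Type*} [Fintype ι] [DecidableEq ι] (L : StrongDual ℝ (ι → ℝ))
    (u : ι → LpI p) :
    charFunDual (Measure.map (fun t i => u i t) unitMeasure) L =
      charFun (Measure.map (∑ i, L (Pi.single i 1) • u i : LpI p) unitMeasure) 1 := by
  rw [charFunDual_eq_charFun_map_one, Measure.map_map (by fun_prop) (measurable_coe_pi u)]
  congr 1
  exact Measure.map_congr (coeFn_dual_apply L u)

namespace IsDistributionalEmbedding

variable {S : LpI p →ₗ[ℝ] LpI p}

/-- Linearity upgrades the preservation of single laws to joint laws: a linear combination of the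
images is the image of the linear combination. -/
theorem map_pi_eq (hS : IsDistributionalEmbedding S) {ι : Type*} [Fintype ι] (u : ι → LpI p) :
    Measure.map (fun t i => S (u i) t) unitMeasure = Measure.map (fun t i => u i t) unitMeasure := by
  classical
  have h1 : IsProbabilityMeasure (Measure.map (fun t i => S (u i) t) unitMeasure) :=
    Measure.isProbabilityMeasure_map (measurable_coe_pi _).aemeasurable
  have h2 : IsProbabilityMeasure (Measure.map (fun t i => u i t) unitMeasure) :=
    Measure.isProbabilityMeasure_map (measurable_coe_pi _).aemeasurable
  refine Measure.ext_of_charFunDual (funext fun L => ?_)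
  rw [charFunDual_map_coe L (fun i => S (u i)), charFunDual_map_coe,
    ← hS (∑ i, L (Pi.single i 1) • u i), map_sum]
  simp_rw [map_smul]

theorem ae_of_ae (hS : IsDistributionalEmbedding S) {f : LpI p} {A : Set ℝ} (hA : MeasurableSet A)
    (h : ∀ᵐ t ∂unitMeasure, f t ∈ A) : ∀ᵐ t ∂unitMeasure, S f t ∈ A := by
  have := (ae_map_iff (measurable_coe f).aemeasurable hA).2 h
  rw [← hS f] at this
  exact (ae_map_iff (measurable_coe (S f)).aemeasurable hA).1 this

theorem map_const (hS : IsDistributionalEmbedding S) (c : ℝ) :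
    S (Lp.const p unitMeasure c) = Lp.const p unitMeasure c := by
  apply Lp.ext
  have h := hS.ae_of_ae (f := Lp.const p unitMeasure c) (measurableSet_singleton c)
    (Lp.coeFn_const p unitMeasure c)
  filter_upwards [h, Lp.coeFn_const p unitMeasure c] with t h1 h2
  rw [h2]; exact h1

theorem integral_eq (hS : IsDistributionalEmbedding S) (f : LpI p) :
    ∫ t, S f t ∂unitMeasure = ∫ t, f t ∂unitMeasure := by
  have h := fun g : LpI p => integral_map (μ := unitMeasure) (measurable_coe g).aemeasurable
    (f := fun x : ℝ => x) aestronglyMeasurable_id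
  rw [← h, ← h, hS]

theorem norm_eq (hS : IsDistributionalEmbedding S) (f : LpI p) : ‖S f‖ = ‖f‖ := by
  have h := fun g : LpI p => eLpNorm_map_measure (μ := unitMeasure) (p := p) (f := g)
    (g := fun x : ℝ => x) aestronglyMeasurable_id (measurable_coe g).aemeasurable
  rw [Lp.norm_def, Lp.norm_def]
  change (eLpNorm ((fun x : ℝ => x) ∘ (S f : ℝ → ℝ)) p unitMeasure).toReal =
    (eLpNorm ((fun x : ℝ => x) ∘ (f : ℝ → ℝ)) p unitMeasure).toReal
  rw [← h, ← h, hS]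

theorem injective [Fact (1 ≤ p)] (hS : IsDistributionalEmbedding S) : Function.Injective S := by
  rw [← LinearMap.ker_eq_bot, LinearMap.ker_eq_bot']
  intro f hf
  rw [← norm_eq_zero, ← hS.norm_eq, hf, norm_zero]

theorem continuous [Fact (1 ≤ p)] (hS : IsDistributionalEmbedding S) : Continuous S :=
  AddMonoidHomClass.continuous_of_bound S 1 fun f => by rw [hS.norm_eq, one_mul]

theorem mem_meanZero [Fact (1 ≤ p)] (hS : IsDistributionalEmbedding S) {f : LpI p}
    (hf : f ∈ meanZero p) : S f ∈ meanZero p :=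
  (hS.integral_eq f).trans hf

end IsDistributionalEmbedding

/-- The hypothesis provides independence for one function per index. By characteristic functions,
independence of two vectors reduces to that of a linear combination of each, and by linearity these
are sums of one function per range. -/
theorem IsIndependentSystem.indepFun_pi
    {T : Ordinal.{0} → Ordinal.{0} → LpI p →ₗ[ℝ] LpI p} (hT : IsIndependentSystem T)
    {α : Ordinal.{0}} (hα : α < ω₁) (hlim : Order.IsSuccLimit α) {β : Ordinal.{0}} (hβ : β < α)
    {ι κ : Type*} [Fintype ι] [Fintype κ] (U : ι → LpI p) (b : κ → Ordinal.{0})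
    (hb : ∀ k, b k < α ∧ b k ≠ β) (V : κ → LpI p) :
    IndepFun (fun t k => T α (b k) (V k) t) (fun t i => T α β (U i) t) unitMeasure := by
  classical
  rw [indepFun_iff_charFunDual_prod (measurable_coe_pi _).aemeasurable
    (measurable_coe_pi _).aemeasurable]
  intro L
  set L₁ := L.comp (.inl ℝ (κ → ℝ) (ι → ℝ))
  set L₂ := L.comp (.inr ℝ (κ → ℝ) (ι → ℝ))
  have hL : ∀ x y, L (x, y) = L₁ x + L₂ y := fun x y => by
    simp [L₁, L₂, ← map_add]
  set g : κ → LpI p := fun k => T α (b k) (V k)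
  set h : ι → LpI p := fun i => T α β (U i)
  rw [charFunDual_map_coe L₁ g, charFunDual_map_coe L₂ h, charFunDual_eq_charFun_map_one,
    Measure.map_map (by fun_prop) ((measurable_coe_pi g).prodMk (measurable_coe_pi h))]
  set G : LpI p := ∑ k, L₁ (Pi.single k 1) • g k with hGdef
  set H : LpI p := ∑ i, L₂ (Pi.single i 1) • h i with hHdef
  have hind : IndepFun (G : ℝ → ℝ) (H : ℝ → ℝ) unitMeasure := by
    let β' : Set.Iio α := ⟨β, hβ⟩
    let b' : κ → Set.Iio α := fun k => ⟨b k, (hb k).1⟩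
    -- Several `k` may share an index `b k`, so the `V k` are collected along the fibres of `b'`;
    -- the slot `β'` is reserved for the `U i`.
    let F : Set.Iio α → LpI p := fun γ => if γ = β' then ∑ i, L₂ (Pi.single i 1) • U i else
      ∑ k with b' k = γ, L₁ (Pi.single k 1) • V k
    have hiI := ((hT α hα hlim).2 F).indepFun_finsetSum_of_notMem
      (fun γ => measurable_coe _) (s := Finset.univ.image b') (i := β') (by
        simp only [Finset.mem_image, Finset.mem_univ, true_and, not_exists]
        exact fun k hk => (hb k).2 (congrArg Subtype.val hk))
    have e1 : T α β' (F β') = H := by simp [F, hHdef, h, β']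
    have e2 : ∑ γ ∈ Finset.univ.image b', T α γ (F γ) = G := by
      rw [hGdef, ← Finset.sum_fiberwise_of_maps_to (g := b') (t := Finset.univ.image b')
        (fun k _ => Finset.mem_image_of_mem b' (Finset.mem_univ k))]
      refine Finset.sum_congr rfl fun γ hγ => ?_
      have hne : γ ≠ β' := by
        obtain ⟨k, _, rfl⟩ := Finset.mem_image.1 hγ
        exact fun hk => (hb k).2 (congrArg Subtype.val hk)
      simp only [F, if_neg hne, map_sum, map_smul]
      refine Finset.sum_congr rfl fun k hk => ?_
      rw [← (Finset.mem_filter.1 hk).2]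
    refine hiI.congr ?_ ?_
    · rw [← e2]
      exact (Lp.coeFn_finsetSum _ _).symm
    · rw [← e1]
  have key := congrFun (hind.charFun_map_fun_add_eq_mul (measurable_coe G).aemeasurable
    (measurable_coe H).aemeasurable) 1
  rw [Pi.mul_apply] at key
  rw [← key]
  congr 1
  refine Measure.map_congr ?_
  filter_upwards [coeFn_dual_apply L₁ g, coeFn_dual_apply L₂ h] with t h1 h2
  rw [Function.comp_apply, hL, h1, h2]

end

section

/-! ### Ordinals and trees -/

theorem kappa_zero : kappa 0 = 0 := Ordinal.limitRecOn_zero ..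

theorem kappa_add_one (α : Ordinal.{0}) : kappa (α + 1) = kappa α + 1 :=
  Ordinal.limitRecOn_add_one ..

theorem kappa_of_isSuccLimit {α : Ordinal.{0}} (h : Order.IsSuccLimit α) : kappa α = 0 :=
  Ordinal.limitRecOn_limit _ _ _ _ h

theorem exists_eq_add_kappa (α : Ordinal.{0}) :
    ∃ β : Ordinal.{0}, (β = 0 ∨ Order.IsSuccLimit β) ∧ α = β + (kappa α : Ordinal.{0}) := by
  induction α using Ordinal.limitRecOn with
  | zero => exact ⟨0, Or.inl rfl, by simp [kappa_zero]⟩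
  | add_one α ih =>
    obtain ⟨β, hβ, h⟩ := ih
    refine ⟨β, hβ, ?_⟩
    rw [kappa_add_one, Nat.cast_succ, ← add_assoc, ← h]
  | limit α hα _ => exact ⟨α, Or.inr hα, by simp [kappa_of_isSuccLimit hα]⟩

theorem InTree.exists_eq_cons {α : Ordinal.{0}} {lam : List Entry} (h : InTree α lam) :
    ∃ l, lam = Entry.ord α :: l := by
  cases h <;> exact ⟨_, rfl⟩

theorem InTree.ne_nil {α : Ordinal.{0}} {lam : List Entry} (h : InTree α lam) : lam ≠ [] := by
  obtain ⟨l, rfl⟩ := h.exists_eq_cons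
  simp

theorem not_inTree_zero {lam : List Entry} : ¬ InTree 0 lam := by
  intro h
  cases h with
  | head _ h => exact h kappa_zero
  | branch _ _ _ _ h => exact h kappa_zero
  | limit _ _ _ h => exact h.ne_bot rfl

theorem kappaSeq_cons (e : Entry) {mu : List Entry} (h : mu ≠ []) :
    kappaSeq (e :: mu) = kappaSeq mu := by
  unfold kappaSeq
  rw [List.getLast?_cons_of_ne_nil h]

/-! ### The operators $T_\lambda$ along the tree. -/

variable {p : ℝ≥0∞} {T : Ordinal.{0} → Ordinal.{0} → LpI p →ₗ[ℝ] LpI p}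

theorem opSeq_singleton (α : Ordinal.{0}) : opSeq T [Entry.ord α] = LinearMap.id := rfl

theorem opSeq_branch (α : Ordinal.{0}) (J : Dyadic) (mu : List Entry) :
    opSeq T (Entry.ord α :: Entry.int J :: mu) = (J.T p).comp (opSeq T mu) := rfl

theorem InTree.opSeq_limit {β : Ordinal.{0}} {mu : List Entry} (h : InTree β mu)
    (α : Ordinal.{0}) : opSeq T (Entry.ord α :: mu) = (T α β).comp (opSeq T mu) := by
  obtain ⟨l, rfl⟩ := h.exists_eq_cons
  rfl

/-- Each $T_\lambda$ is composed of dyadic compressions and distributional embeddings. Injectivity,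
preservation of mean zero and the bound by 1 are all inherited through these two kinds of operators.
-/
theorem InTree.opSeq_induction (hT : IsIndependentSystem T) {Q : (LpI p →ₗ[ℝ] LpI p) → Prop}
    (hid : Q LinearMap.id) (hint : ∀ (J : Dyadic) (S), Q S → Q ((J.T p).comp S))
    (hdist : ∀ S' S : LpI p →ₗ[ℝ] LpI p, IsDistributionalEmbedding S' → Q S → Q (S'.comp S))
    {α : Ordinal.{0}} {lam : List Entry} (h : InTree α lam) (hα : α < ω₁) : Q (opSeq T lam) := by
  induction h with
  | head α h => exact hid
  | branch α β J mu _ hαβ _ hmu ih =>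
    rw [opSeq_branch]
    refine hint J _ (ih (lt_of_le_of_lt ?_ hα))
    rw [hαβ]; exact le_self_add
  | limit α β mu hlim _ hβ hmu ih =>
    rw [hmu.opSeq_limit]
    exact hdist _ _ ((hT α hα hlim).1 β hβ) (ih (hβ.trans hα))

theorem InTree.opSeq_injective [Fact (1 ≤ p)] (hp : p ≠ ∞) (hT : IsIndependentSystem T)
    {α : Ordinal.{0}} {lam : List Entry} (h : InTree α lam) (hα : α < ω₁) :
    Function.Injective (opSeq T lam) :=
  h.opSeq_induction hT (Q := fun S => Function.Injective S) Function.injective_id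
    (fun J _ hS => (J.T_injective hp).comp hS) (fun _ _ hS' hS => hS'.injective.comp hS) hα

theorem InTree.opSeq_mem_meanZero [Fact (1 ≤ p)] (hT : IsIndependentSystem T)
    {α : Ordinal.{0}} {lam : List Entry} (h : InTree α lam) (hα : α < ω₁) :
    ∀ f ∈ meanZero p, opSeq T lam f ∈ meanZero p :=
  h.opSeq_induction hT (Q := fun S => ∀ f ∈ meanZero p, S f ∈ meanZero p) (fun _ hf => hf)
    (fun J _ hS f hf => J.T_mem_meanZero (hS f hf))
    (fun _ _ hS' hS f hf => hS'.mem_meanZero (hS f hf)) hα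

theorem ae_rescale {J : Dyadic} {f : ℝ → ℝ} {A : Set ℝ} (h : ∀ᵐ t ∂unitMeasure, f t ∈ A) :
    ∀ᵐ t ∂unitMeasure, t ∈ J.toSet → f ((t - J.left) / (J.right - J.left)) ∈ A := by
  have h1 := (quasiMeasurePreserving_rescale J.left_lt_right).ae h
  rwa [ae_restrict_iff' measurableSet_Ico] at h1

theorem Dyadic.T_eq_on (J : Dyadic) (f : LpI p) : ∀ᵐ t ∂unitMeasure,
    (t ∈ J.toSet → J.T p f t = f ((t - J.left) / (J.right - J.left))) ∧
    (t ∉ J.toSet → J.T p f t = 0) := by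
  filter_upwards [J.coeFn_T f] with t ht
  rw [ht, compressFun]
  exact ⟨fun h => Set.indicator_of_mem h _, fun h => Set.indicator_of_notMem h _⟩

theorem InTree.abs_haarSeq_le (hT : IsIndependentSystem T)
    {α : Ordinal.{0}} {lam : List Entry} (h : InTree α lam) (hα : α < ω₁) (I : Dyadic) :
    ∀ᵐ t ∂unitMeasure, |haarSeq T lam I t| ≤ 1 := by
  have hcl : MeasurableSet {x : ℝ | |x| ≤ 1} := measurableSet_le (by fun_prop) (by fun_prop)
  refine h.opSeq_induction hT (Q := fun S => ∀ᵐ t ∂unitMeasure, S (I.haar p) t ∈ {x : ℝ | |x| ≤ 1})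
    ?_ (fun J S hS => ?_) (fun S' S hS' hS => hS'.ae_of_ae hcl hS) hα
  · filter_upwards [I.coeFn_haar (p := p)] with t ht
    simp only [LinearMap.id_apply, ht]
    exact I.abs_haarFun_le t
  · filter_upwards [ae_rescale (J := J) hS, J.T_eq_on (S (I.haar p))] with t h1 h2
    rw [LinearMap.comp_apply]
    by_cases ht : t ∈ J.toSet
    · rw [h2.1 ht]; exact h1 ht
    · rw [h2.2 ht]; simp

/-! ### Orthogonality of `h_I^λ` to earlier functions -/

/-- The pair `a` may precede the pair `b` in a compatible enumeration. -/
def MayPrecede (a b : List Entry × Dyadic) : Prop :=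
  (¬ a.1 <+: b.1 ∧ ¬ b.1 <+: a.1) ∨ (a.1 <+: b.1 ∧ a.1 ≠ b.1) ∨ (a.1 = b.1 ∧ a.2.LexLT b.2)

theorem mayPrecede_cons_iff {e : Entry} {l m : List Entry} {I J : Dyadic} :
    MayPrecede (e :: l, I) (e :: m, J) ↔ MayPrecede (l, I) (m, J) := by
  simp [MayPrecede, List.cons_prefix_cons]

/-- `g` is orthogonal to all bounded functions of the family `f`. -/
def OrthogonalToFamily {ι : Type*} (f : ι → LpI p) (g : LpI p) : Prop :=
  ∀ ψ : (ι → ℝ) → ℝ, Measurable ψ → (∃ C, ∀ v, |ψ v| ≤ C) →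
    ∫ t, ψ (fun k => f k t) * g t ∂unitMeasure = 0

/-- Any function of the family is constant on the support of `h_I`, which integrates to zero. -/
theorem orthogonalToFamily_haar {ι : Type*} [Countable ι] {f : ι → LpI p} {I : Dyadic}
    (hf : ∀ k, ∃ c : ℝ, ∀ᵐ t ∂unitMeasure, t ∈ I.toSet → f k t = c) :
    OrthogonalToFamily f (I.haar p) := by
  intro ψ _ _
  choose c hc using hf
  have : (fun t => ψ (fun k => f k t) * I.haar p t) =ᵐ[unitMeasure]
      fun t => ψ c * I.haarFun t := by
    filter_upwards [ae_all_iff.2 hc, I.coeFn_haar (p := p)] with t h1 h2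
    rw [h2]
    by_cases ht : t ∈ I.toSet
    · rw [funext fun k => h1 k ht]
    · rw [Dyadic.haarFun_of_notMem ht, mul_zero, mul_zero]
  rw [integral_congr_ae this, integral_const_mul, Dyadic.integral_haarFun, mul_zero]

/-- Since `T_J g'` vanishes off `J`, only the values of the family on `J` matter, and rescaling `J`
multiplies the integral by its length. -/
theorem OrthogonalToFamily.compress {ι : Type*} [Countable ι] {f f' : ι → LpI p} {g' : LpI p}
    {J : Dyadic} (h : OrthogonalToFamily f' g')
    (hf : ∀ k, ∀ᵐ t ∂unitMeasure, t ∈ J.toSet →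
      f k t = f' k ((t - J.left) / (J.right - J.left))) :
    OrthogonalToFamily f (J.T p g') := by
  intro ψ hψ hb
  have : (fun t => ψ (fun k => f k t) * J.T p g' t) =ᵐ[unitMeasure]
      J.toSet.indicator fun t => (fun s => ψ (fun k => f' k s) * g' s)
        ((t - J.left) / (J.right - J.left)) := by
    filter_upwards [ae_all_iff.2 hf, J.T_eq_on g'] with t h1 h2
    by_cases ht : t ∈ J.toSet
    · rw [Set.indicator_of_mem ht, h2.1 ht, funext fun k => h1 k ht]
    · rw [Set.indicator_of_notMem ht, h2.2 ht, mul_zero]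
  rw [integral_congr_ae this, integral_indicator J.measurableSet_toSet, Dyadic.toSet,
    setIntegral_rescale (F := fun s => ψ (fun k => f' k s) * g' s) J.left_nonneg J.left_lt_right
      J.right_le_one (((hψ.comp (measurable_coe_pi f')).mul (measurable_coe g')).aestronglyMeasurable),
    h ψ hψ hb, mul_zero]

/-- The parts `T α (b k) (V k)` are independent of the range of `T α β`. Once they are frozen at a
value `y`, the test function becomes the translate `ψ (· + y)`, and equality of joint laws replaces
the images of `U` and `g` by `U` and `g` themselves. -/
theorem OrthogonalToFamily.limit (hT : IsIndependentSystem T)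
    {α : Ordinal.{0}} (hα : α < ω₁) (hlim : Order.IsSuccLimit α) {β : Ordinal.{0}} (hβ : β < α)
    {ι : Type*} [Fintype ι] {f U V : ι → LpI p} {b : ι → Ordinal.{0}} {g : LpI p}
    (hg : ∀ᵐ t ∂unitMeasure, |g t| ≤ 1) (h : OrthogonalToFamily U g)
    (hb : ∀ k, b k < α ∧ b k ≠ β) (hf : ∀ k, f k = T α β (U k) + T α (b k) (V k)) :
    OrthogonalToFamily f (T α β g) := by
  intro ψ hψ ⟨C, hC⟩
  have hS := (hT α hα hlim).1 β hβ
  have hcl : MeasurableSet {x : ℝ | |x| ≤ 1} := measurableSet_le (by fun_prop) (by fun_prop)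
  set W : Option ι → LpI p := fun o => o.elim g U
  set X : ℝ → Option ι → ℝ := fun t o => T α β (W o) t
  set Y : ℝ → ι → ℝ := fun t k => T α (b k) (V k) t
  have hX : Measurable X := measurable_coe_pi _
  have hY : Measurable Y := measurable_coe_pi _
  have hind : IndepFun Y X unitMeasure := hT.indepFun_pi hα hlim hβ W b hb V
  -- Clipping makes `G` bounded on the whole product space, as needed for Fubini; it is harmless
  -- because `g` is a.e. bounded by 1.
  let G : (ι → ℝ) × (Option ι → ℝ) → ℝ := fun z =>
    ψ (fun k => z.2 (some k) + z.1 k) * clip (z.2 none)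
  have hGm : Measurable G := by
    refine (hψ.comp (measurable_pi_lambda _ fun k => ?_)).mul (measurable_clip.comp ?_)
    · exact ((measurable_pi_apply _).comp measurable_snd).add
        ((measurable_pi_apply _).comp measurable_fst)
    · exact (measurable_pi_apply _).comp measurable_snd
  have h1 : (fun t => ψ (fun k => f k t) * T α β g t) =ᵐ[unitMeasure] fun t => G (Y t, X t) := by
    have hsum : ∀ᵐ t ∂unitMeasure, ∀ k, f k t = T α β (U k) t + T α (b k) (V k) t :=
      ae_all_iff.2 fun k => by rw [hf k]; exact Lp.coeFn_add _ _
    filter_upwards [hsum, hS.ae_of_ae hcl hg] with t h1 h2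
    simp only [G, X, Y, W, Option.elim]
    rw [funext h1, clip_of_abs_le h2]
  have hpX : IsProbabilityMeasure (Measure.map X unitMeasure) :=
    Measure.isProbabilityMeasure_map hX.aemeasurable
  have hpY : IsProbabilityMeasure (Measure.map Y unitMeasure) :=
    Measure.isProbabilityMeasure_map hY.aemeasurable
  rw [integral_congr_ae h1, ← integral_map (φ := fun t => (Y t, X t)) (hY.prodMk hX).aemeasurable
    hGm.aestronglyMeasurable, (indepFun_iff_map_prod_eq_prod_map_map hY.aemeasurable
    hX.aemeasurable).1 hind, integral_prod]
  · refine integral_eq_zero_of_ae (Eventually.of_forall fun y => ?_)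
    have hGy : Measurable fun x => G (y, x) := hGm.comp measurable_prodMk_left
    change ∫ x, G (y, x) ∂(Measure.map X unitMeasure) = 0
    rw [hS.map_pi_eq W, integral_map (measurable_coe_pi W).aemeasurable hGy.aestronglyMeasurable,
      ← h (fun u => ψ fun k => u k + y k) (hψ.comp (measurable_pi_lambda _ fun k =>
        (measurable_pi_apply k).add_const _)) ⟨C, fun v => hC _⟩]
    refine integral_congr_ae ?_
    filter_upwards [hg] with t ht
    simp only [G, W, Option.elim]
    rw [clip_of_abs_le ht]
  · refine Integrable.of_bound hGm.aestronglyMeasurable C (Eventually.of_forall fun z => ?_)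
    rw [Real.norm_eq_abs, abs_mul]
    calc _ ≤ C * 1 := mul_le_mul (hC _) (abs_clip_le _) (abs_nonneg _) ((abs_nonneg _).trans (hC 0))
      _ = C := mul_one C

/-- The functions `h_I^λ` are orthogonal to the functions of earlier members of the system. -/
theorem InTree.orthogonalToFamily_haarSeq (hT : IsIndependentSystem T)
    {α : Ordinal.{0}} {lam : List Entry} (h : InTree α lam) (hα : α < ω₁) {I : Dyadic}
    {ι : Type*} [Fintype ι] (f : ι → LpI p)
    (hf : ∀ k, (∃ c, f k = Lp.const p unitMeasure c) ∨ ∃ mu J, InTree α mu ∧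
      J.level < kappaSeq mu ∧ MayPrecede (mu, J) (lam, I) ∧ f k = haarSeq T mu J) :
    OrthogonalToFamily f (haarSeq T lam I) := by
  have hconst : ∀ c : ℝ, ∀ᵐ t ∂unitMeasure, Lp.const p unitMeasure c t ∈ ({c} : Set ℝ) :=
    fun c => Lp.coeFn_const p unitMeasure c
  induction h generalizing f with
  | head α hκ =>
    refine orthogonalToFamily_haar fun k => ?_
    rcases hf k with ⟨c, hc⟩ | ⟨mu, J, hmu, hJ, hprec, hfk⟩
    · exact ⟨c, by rw [hc]; filter_upwards [hconst c] with t ht _ using ht⟩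
    · obtain ⟨l, rfl⟩ := hmu.exists_eq_cons
      -- The node `(α)` is an initial segment of every member of the tree, so only this node itself,
      -- with an earlier interval, may precede.
      have : l = [] ∧ J.LexLT I := by
        simpa [MayPrecede, List.cons_prefix_cons, List.prefix_nil] using hprec
      obtain ⟨rfl, hlt⟩ := this
      obtain ⟨c, hc⟩ := Dyadic.haarFun_const_on_of_lexLT hlt
      refine ⟨c, ?_⟩
      rw [hfk, haarSeq, opSeq_singleton, LinearMap.id_apply]
      filter_upwards [J.coeFn_haar (p := p)] with t ht htI
      rw [ht, hc t htI]
  | branch α β K nu hκ hαβ hK hnu ih =>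
    have hβα : β < ω₁ := lt_of_le_of_lt (by rw [hαβ]; exact le_self_add) hα
    -- On `K`, Haar functions of the head are constant, their level being below that of `K`, and
    -- functions of other branches vanish; only the branch through `K` leaves nonconstant terms,
    -- coming from the tree of `β`.
    have key : ∀ k, ∃ f' : LpI p, ((∃ c, f' = Lp.const p unitMeasure c) ∨ ∃ mu J, InTree β mu ∧
        J.level < kappaSeq mu ∧ MayPrecede (mu, J) (nu, I) ∧ f' = haarSeq T mu J) ∧
        ∀ᵐ t ∂unitMeasure, t ∈ K.toSet → f k t = f' ((t - K.left) / (K.right - K.left)) := by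
      intro k
      have hc : ∀ c : ℝ, (∀ᵐ t ∂unitMeasure, t ∈ K.toSet → f k t = c) →
          ∀ᵐ t ∂unitMeasure, t ∈ K.toSet →
            f k t = Lp.const p unitMeasure c ((t - K.left) / (K.right - K.left)) := fun c h => by
        filter_upwards [h, ae_rescale (J := K) (hconst c)] with t h1 h2 ht
        rw [h1 ht, h2 ht]
      rcases hf k with ⟨c, hfc⟩ | ⟨mu, J, hmu, hJ, hprec, hfk⟩
      · refine ⟨Lp.const p unitMeasure c, Or.inl ⟨c, rfl⟩, hc c ?_⟩
        rw [hfc]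
        filter_upwards [hconst c] with t ht _ using ht
      · rw [hfk] at hc ⊢
        cases hmu with
        | head _ _ =>
          obtain ⟨c, hcJ⟩ := Dyadic.haarFun_const_on (I := J) (J := K) (by rw [hK]; exact hJ)
          refine ⟨_, Or.inl ⟨c, rfl⟩, hc c ?_⟩
          filter_upwards [J.coeFn_haar (p := p)] with t ht htK
          rw [haarSeq, opSeq_singleton, LinearMap.id_apply, ht, hcJ t htK]
        | branch _ β' K' mu _ hαβ' hK' hmu =>
          have hT' := K'.T_eq_on (opSeq T mu (J.haar p))
          by_cases hKK : K' = K
          · subst hKK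
            obtain rfl : β' = β := (Ordinal.add_right_cancel (kappa α)).1 (hαβ'.symm.trans hαβ)
            refine ⟨haarSeq T mu J, Or.inr ⟨mu, J, hmu, ?_, ?_, rfl⟩, ?_⟩
            · rwa [kappaSeq_cons _ (by simp), kappaSeq_cons _ hmu.ne_nil] at hJ
            · rwa [mayPrecede_cons_iff, mayPrecede_cons_iff] at hprec
            · filter_upwards [hT'] with t ht htK using ht.1 htK
          · refine ⟨_, Or.inl ⟨0, rfl⟩, hc 0 ?_⟩
            filter_upwards [hT'] with t ht htK
            exact ht.2 (Set.disjoint_right.1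
              (Dyadic.disjoint_of_level_eq (hK'.trans hK.symm) hKK) htK)
        | limit _ _ _ hlim => exact absurd (kappa_of_isSuccLimit hlim) hκ
    choose f' hf' hff' using key
    exact (ih hβα f' hf').compress hff'
  | limit α β nu hlim hβ1 hβ hnu ih =>
    have hS := (hT α hα hlim).1
    -- As `β ≥ 1`, the index `0` can serve as a dummy different from `β` whenever the second summand
    -- is zero.
    have hβ0 : (0 : Ordinal.{0}) ≠ β := fun h => by
      rw [← h] at hβ1; exact absurd hβ1 (by simp)
    have h0α : (0 : Ordinal.{0}) < α := zero_le.trans_lt hβ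
    have key : ∀ k, ∃ (U : LpI p) (b : Ordinal.{0}) (V : LpI p),
        ((∃ c, U = Lp.const p unitMeasure c) ∨ ∃ mu J, InTree β mu ∧
        J.level < kappaSeq mu ∧ MayPrecede (mu, J) (nu, I) ∧ U = haarSeq T mu J) ∧
        (b < α ∧ b ≠ β) ∧ f k = T α β U + T α b V := by
      intro k
      rcases hf k with ⟨c, hfc⟩ | ⟨mu, J, hmu, hJ, hprec, hfk⟩
      · exact ⟨_, 0, 0, Or.inl ⟨c, rfl⟩, ⟨h0α, hβ0⟩, by
          rw [(hS β hβ).map_const, map_zero, add_zero, hfc]⟩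
      · cases hmu with
        | head _ h => exact absurd (kappa_of_isSuccLimit hlim) h
        | branch _ _ _ _ h => exact absurd (kappa_of_isSuccLimit hlim) h
        | limit _ β' mu _ _ hβ' hmu =>
          have hop : f k = T α β' (haarSeq T mu J) := by
            rw [hfk, haarSeq, hmu.opSeq_limit]; rfl
          by_cases hββ : β' = β
          · subst hββ
            refine ⟨haarSeq T mu J, 0, 0, Or.inr ⟨mu, J, hmu, ?_, ?_, rfl⟩, ⟨h0α, hβ0⟩, ?_⟩
            · rwa [kappaSeq_cons _ hmu.ne_nil] at hJ
            · rwa [mayPrecede_cons_iff] at hprec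
            · rw [map_zero, add_zero, hop]
          · exact ⟨_, β', haarSeq T mu J, Or.inl ⟨0, rfl⟩, ⟨hβ', hββ⟩, by
              rw [map_zero, map_zero, zero_add, hop]⟩
    choose U b V hU hb hfk using key
    have := (ih (hβ.trans hα) U hU).limit hT hα hlim hβ
      (hnu.abs_haarSeq_le hT (hβ.trans hα) I) hb hfk
    rwa [haarSeq, hnu.opSeq_limit]

end

section

/-! ### The structure of `R_α^{p,0}` -/

variable {p : ℝ≥0∞}

/-- The constant function `1`. -/
abbrev one (p : ℝ≥0∞) : LpI p := Lp.const p unitMeasure (1 : ℝ)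

theorem Dyadic.T_one (J : Dyadic) : J.T p (one p) = J.char p := by
  rw [T_const, one_smul]

theorem char_unit : Dyadic.unit.char p = one p := by
  rw [← Dyadic.T_one, Dyadic.T_unit]

variable [Fact (1 ≤ p)]

theorem abs_integral_le_norm (f : LpI p) : |∫ t, f t ∂unitMeasure| ≤ ‖f‖ := by
  have h1 : Integrable (f : ℝ → ℝ) unitMeasure := (Lp.memLp f).integrable Fact.out
  calc |∫ t, f t ∂unitMeasure| ≤ ∫ t, ‖f t‖ ∂unitMeasure := norm_integral_le_integral_norm (f : ℝ → ℝ)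
    _ = (eLpNorm f 1 unitMeasure).toReal := by
        rw [eLpNorm_one_eq_lintegral_enorm, integral_norm_eq_lintegral_enorm h1.1]
    _ ≤ ‖f‖ := by
        rw [Lp.norm_def]
        exact ENNReal.toReal_mono (Lp.eLpNorm_ne_top f)
          (eLpNorm_le_eLpNorm_of_exponent_le Fact.out (Lp.aestronglyMeasurable f))

/-- The expectation as a continuous linear functional on `L_p`. -/
def mean (p : ℝ≥0∞) [Fact (1 ≤ p)] : LpI p →L[ℝ] ℝ :=
  LinearMap.mkContinuous
    { toFun := fun f => ∫ t, f t ∂unitMeasure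
      map_add' := fun f g => by
        rw [integral_congr_ae (Lp.coeFn_add f g)]
        exact integral_add ((Lp.memLp f).integrable Fact.out) ((Lp.memLp g).integrable Fact.out)
      map_smul' := fun c f => by
        rw [integral_congr_ae (Lp.coeFn_smul c f)]
        exact integral_smul c (f : ℝ → ℝ) } 1 fun f => by rw [one_mul]; exact abs_integral_le_norm f

theorem mean_apply (f : LpI p) : mean p f = ∫ t, f t ∂unitMeasure := rfl

theorem mem_meanZero_iff {f : LpI p} : f ∈ meanZero p ↔ mean p f = 0 := Iff.rfl

theorem isClosed_meanZero : IsClosed (meanZero p : Set (LpI p)) :=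
  isClosed_eq (mean p).continuous continuous_const

theorem mean_one : mean p (one p) = 1 := by
  rw [mean_apply, integral_congr_ae (Lp.coeFn_const p unitMeasure (1 : ℝ))]
  simp

/-- The projection `f ↦ f - 𝔼 f`. -/
def center (p : ℝ≥0∞) [Fact (1 ≤ p)] : LpI p →L[ℝ] LpI p :=
  ContinuousLinearMap.id ℝ _ - (mean p).smulRight (one p)

theorem center_apply (f : LpI p) : center p f = f - mean p f • one p := rfl

theorem center_mem_meanZero (f : LpI p) : center p f ∈ meanZero p := by
  rw [mem_meanZero_iff, center_apply, map_sub, map_smul, mean_one, smul_eq_mul, mul_one, sub_self]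

theorem center_of_mem {f : LpI p} (hf : f ∈ meanZero p) : center p f = f := by
  rw [center_apply, mem_meanZero_iff.1 hf, zero_smul, sub_zero]

theorem Dyadic.T_eq_center_add (J : Dyadic) (f : LpI p) :
    J.T p f = mean p f • J.char p + J.T p (center p f) := by
  rw [← J.T_one, center_apply, map_sub, map_smul]
  abel

/-- The two compressions have disjoint supports, so `(f, g) ↦ L f + R g` is bounded below and hence
a closed embedding. -/
theorem isClosed_sup_compress (hp : p ≠ ∞) {A : Submodule ℝ (LpI p)}
    (hA : IsClosed (A : Set (LpI p))) :
    IsClosed ((A.map (compress p 0 (1 / 2) (by norm_num)) ⊔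
      A.map (compress p (1 / 2) 1 (by norm_num)) : Submodule ℝ (LpI p)) : Set (LpI p)) := by
  set L : LpI p →ₗ[ℝ] LpI p := compress p 0 (1 / 2) (by norm_num)
  set R : LpI p →ₗ[ℝ] LpI p := compress p (1 / 2) 1 (by norm_num)
  set c : ℝ := (1 / 2) ^ (1 / p.toReal) with hc
  have hc0 : 0 < c := by positivity
  have hL : ∀ f, ‖L f‖ = c * ‖f‖ := fun f => by
    rw [norm_compress hp le_rfl (by norm_num) (by norm_num), sub_zero]
  have hR : ∀ f, ‖R f‖ = c * ‖f‖ := fun f => by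
    rw [norm_compress hp (by norm_num) (by norm_num) le_rfl, hc]; norm_num
  have hpt : ∀ f g, ∀ᵐ t ∂unitMeasure, ‖L f t‖ ≤ ‖(L f + R g : LpI p) t‖ ∧
      ‖R g t‖ ≤ ‖(L f + R g : LpI p) t‖ := fun f g => by
    filter_upwards [coeFn_compress (show (0 : ℝ) < 1 / 2 by norm_num) f,
      coeFn_compress (show (1 / 2 : ℝ) < 1 by norm_num) g, Lp.coeFn_add (L f) (R g)] with t h1 h2 h3
    rw [h3, Pi.add_apply]
    by_cases ht : t < 1 / 2
    · have : R g t = 0 := by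
        rw [h2, compressFun, Set.indicator_of_notMem fun h => absurd h.1 (not_le.2 ht)]
      simp [this]
    · have : L f t = 0 := by
        rw [h1, compressFun, Set.indicator_of_notMem fun h => ht h.2]
      simp [this]
  have hΦc : Continuous (L.coprod R) := by
    have h1 : Continuous L := continuous_compress hp le_rfl (by norm_num) (by norm_num)
    have h2 : Continuous R := continuous_compress hp (by norm_num) (by norm_num) le_rfl
    exact (h1.comp continuous_fst).add (h2.comp continuous_snd)
  have hanti : AntilipschitzWith (Real.toNNReal c⁻¹) (L.coprod R) := by
    refine AddMonoidHomClass.antilipschitz_of_bound _ fun z => ?_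
    rw [Real.coe_toNNReal _ (by positivity), LinearMap.coprod_apply, ← div_eq_inv_mul,
      le_div_iff₀ hc0, Prod.norm_def, mul_comm, mul_max_of_nonneg _ _ hc0.le, ← hL, ← hR]
    exact max_le (Lp.norm_le_norm_of_ae_le ((hpt _ _).mono fun t h => h.1))
      (Lp.norm_le_norm_of_ae_le ((hpt _ _).mono fun t h => h.2))
  have hemb := hanti.isClosedEmbedding
    (ContinuousLinearMap.uniformContinuous (⟨L.coprod R, hΦc⟩ : LpI p × LpI p →L[ℝ] LpI p))
  have heq : (A.prod A).map (L.coprod R) = A.map L ⊔ A.map R := LinearMap.map_coprod_prod _ _ _ _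
  rw [← heq, Submodule.map_coe, Submodule.prod_coe]
  exact hemb.isClosedMap _ (hA.prod hA)

/-! ### The spaces $R_\alpha^p$ and density of the Haar span. -/

variable {T : Ordinal.{0} → Ordinal.{0} → LpI p →ₗ[ℝ] LpI p}

theorem R_zero : R T 0 = ℝ ∙ one p := Ordinal.limitRecOn_zero ..

theorem R_add_one (α : Ordinal.{0}) : R T (α + 1) =
    (R T α).map (compress p 0 (1 / 2) (by norm_num)) ⊔
      (R T α).map (compress p (1 / 2) 1 (by norm_num)) := Ordinal.limitRecOn_add_one ..

theorem R_limit {α : Ordinal.{0}} (h : Order.IsSuccLimit α) :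
    R T α = (⨆ β : Set.Iio α, (R T β.1).map (T α β)).topologicalClosure :=
  Ordinal.limitRecOn_limit _ _ _ _ h

theorem isClosed_R (hp : p ≠ ∞) (α : Ordinal.{0}) : IsClosed (R T α : Set (LpI p)) := by
  induction α using Ordinal.limitRecOn with
  | zero => rw [R_zero]; exact Submodule.closed_of_finiteDimensional _
  | add_one α ih => rw [R_add_one]; exact isClosed_sup_compress hp ih
  | limit α hα _ => rw [R_limit hα]; exact Submodule.isClosed_topologicalClosure _

theorem isClosed_R0 (hp : p ≠ ∞) (α : Ordinal.{0}) : IsClosed (R0 T α : Set (LpI p)) :=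
  (isClosed_R hp α).inter isClosed_meanZero

theorem map_T_le_R_of_limit {α β : Ordinal.{0}} (h : Order.IsSuccLimit α) (hβ : β < α) :
    (R T β).map (T α β) ≤ R T α := by
  rw [R_limit h]
  exact (le_iSup (fun β : Set.Iio α => (R T β.1).map (T α β)) ⟨β, hβ⟩).trans
    (Submodule.le_topologicalClosure _)

theorem T_mem_R_add_nat (β : Ordinal.{0}) {k : ℕ} {J : Dyadic} (hJ : J.level = k) {f : LpI p}
    (hf : f ∈ R T β) : J.T p f ∈ R T (β + k) := by
  induction k generalizing J with
  | zero => rwa [Dyadic.eq_unit hJ, Dyadic.T_unit, Nat.cast_zero, add_zero]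
  | succ k ih =>
    rw [Nat.cast_succ, ← add_assoc, R_add_one]
    obtain ⟨K, hK, rfl | rfl⟩ := Dyadic.eq_inLeft_or_inRight hJ
    · rw [← Dyadic.compress_left_T]
      exact Submodule.mem_sup_left (Submodule.mem_map_of_mem (ih hK))
    · rw [← Dyadic.compress_right_T]
      exact Submodule.mem_sup_right (Submodule.mem_map_of_mem (ih hK))

theorem R_add_nat_le (β : Ordinal.{0}) (k : ℕ) {W : Submodule ℝ (LpI p)}
    (hW : ∀ J : Dyadic, J.level = k → ∀ f ∈ R T β, J.T p f ∈ W) : R T (β + k) ≤ W := by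
  induction k generalizing W with
  | zero =>
    intro f hf
    rw [Nat.cast_zero, add_zero] at hf
    simpa [Dyadic.T_unit] using hW Dyadic.unit rfl f hf
  | succ k ih =>
    rw [Nat.cast_succ, ← add_assoc, R_add_one]
    refine sup_le ?_ ?_ <;> rw [Submodule.map_le_iff_le_comap] <;> refine ih fun J hJ f hf => ?_
    · rw [Submodule.mem_comap, Dyadic.compress_left_T]
      exact hW _ (by simp [Dyadic.inLeft, hJ]) f hf
    · rw [Submodule.mem_comap, Dyadic.compress_right_T]
      exact hW _ (by simp [Dyadic.inRight, hJ]) f hf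

theorem span_char_le_R {β : Ordinal.{0}} (hone : one p ∈ R T β) (k : ℕ) :
    Submodule.span ℝ (Dyadic.char p '' {I : Dyadic | I.level = k}) ≤ R T (β + k) := by
  rw [Submodule.span_le]
  rintro _ ⟨J, hJ, rfl⟩
  rw [← J.T_one]
  exact T_mem_R_add_nat _ hJ hone

theorem one_mem_R (hT : IsIndependentSystem T) {α : Ordinal.{0}} (hα : α < ω₁) :
    one p ∈ R T α := by
  induction α using Ordinal.limitRecOn with
  | zero => rw [R_zero]; exact Submodule.mem_span_singleton_self _
  | add_one α ih =>
    have := span_char_le_R (ih ((lt_add_one α).trans hα)) 1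
    rw [Nat.cast_one] at this
    rw [← char_unit]
    exact this (Dyadic.char_mem_span_of_le _ 1 (by simp [Dyadic.unit]))
  | limit α h _ =>
    have h0 : (0 : Ordinal.{0}) < α := h.bot_lt
    rw [one, ← ((hT α hα h).1 0 h0).map_const]
    refine map_T_le_R_of_limit h h0 (Submodule.mem_map_of_mem ?_)
    rw [R_zero]; exact Submodule.mem_span_singleton_self _

theorem center_mem_R0 (hT : IsIndependentSystem T) {α : Ordinal.{0}} (hα : α < ω₁) {f : LpI p}
    (hf : f ∈ R T α) : center p f ∈ R0 T α :=
  ⟨sub_mem hf (Submodule.smul_mem _ _ (one_mem_R hT hα)), center_mem_meanZero f⟩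

theorem InTree.haarSeq_mem_R (hT : IsIndependentSystem T) {α : Ordinal.{0}} {lam : List Entry}
    (h : InTree α lam) (hα : α < ω₁) {I : Dyadic} (hI : I.level < kappaSeq lam) :
    haarSeq T lam I ∈ R T α := by
  induction h with
  | head α hκ =>
    obtain ⟨β, _, hβ⟩ := exists_eq_add_kappa α
    have hβω : β < ω₁ := lt_of_le_of_lt (by rw [hβ]; exact le_self_add) hα
    have := span_char_le_R (one_mem_R hT hβω) (kappa α)
    rw [← hβ] at this
    exact this (Dyadic.haar_mem_dyadicMeanZero hI).1
  | branch α β K nu hκ hαβ hK hnu ih =>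
    have hβω : β < ω₁ := lt_of_le_of_lt (by rw [hαβ]; exact le_self_add) hα
    rw [kappaSeq_cons _ (by simp), kappaSeq_cons _ hnu.ne_nil] at hI
    have := T_mem_R_add_nat β hK (ih hβω hI)
    rwa [← hαβ] at this
  | limit α β nu hlim _ hβ hnu ih =>
    rw [kappaSeq_cons _ hnu.ne_nil] at hI
    rw [haarSeq, hnu.opSeq_limit]
    exact map_T_le_R_of_limit hlim hβ (Submodule.mem_map_of_mem (ih (hβ.trans hα) hI))

/-- The linear span of all functions `h_I^λ`, `λ ∈ 𝒯_α`. -/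
def haarSpan (T : Ordinal.{0} → Ordinal.{0} → LpI p →ₗ[ℝ] LpI p) (α : Ordinal.{0}) :
    Submodule ℝ (LpI p) :=
  Submodule.span ℝ ((fun x : List Entry × Dyadic => haarSeq T x.1 x.2) '' haarIndex α)

theorem InTree.haarSeq_mem_R0 (hT : IsIndependentSystem T) {α : Ordinal.{0}} {lam : List Entry}
    (h : InTree α lam) (hα : α < ω₁) {I : Dyadic} (hI : I.level < kappaSeq lam) :
    haarSeq T lam I ∈ R0 T α :=
  ⟨h.haarSeq_mem_R hT hα hI, h.opSeq_mem_meanZero hT hα _ (Dyadic.integral_haar I)⟩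

/-- Closedness of `R0 T α` is essential here: at successors `R` is a sum without closure. -/
theorem closure_haarSpan_le (hp : p ≠ ∞) (hT : IsIndependentSystem T) {α : Ordinal.{0}}
    (hα : α < ω₁) : (haarSpan T α).topologicalClosure ≤ R0 T α := by
  refine Submodule.topologicalClosure_minimal _ ?_ (isClosed_R0 hp α)
  rw [haarSpan, Submodule.span_le]
  rintro _ ⟨x, ⟨hx, hI⟩, rfl⟩
  exact hx.haarSeq_mem_R0 hT hα hI

theorem closure_haarSpan_le_comap {α β : Ordinal.{0}} {S : LpI p →ₗ[ℝ] LpI p} (hS : Continuous S)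
    (h : ∀ lam I, InTree β lam → I.level < kappaSeq lam → S (haarSeq T lam I) ∈ haarSpan T α) :
    (haarSpan T β).topologicalClosure ≤ (haarSpan T α).topologicalClosure.comap S := by
  refine Submodule.topologicalClosure_minimal _ ?_
    ((Submodule.isClosed_topologicalClosure _).preimage hS)
  rw [haarSpan, Submodule.span_le]
  rintro _ ⟨x, ⟨hx, hI⟩, rfl⟩
  exact Submodule.le_topologicalClosure _ (h _ _ hx hI)

theorem R0_le_closure_haarSpan (hp : p ≠ ∞) (hT : IsIndependentSystem T) {α : Ordinal.{0}}
    (hα : α < ω₁) : R0 T α ≤ (haarSpan T α).topologicalClosure := by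
  induction α using WellFoundedLT.induction with
  | ind α ih =>
  obtain ⟨β, hβ, hαβ⟩ := exists_eq_add_kappa α
  by_cases hκ : kappa α = 0
  · rw [hκ, Nat.cast_zero, add_zero] at hαβ
    subst hαβ
    rcases hβ with rfl | hlim
    · rintro f ⟨hf, hf0⟩
      rw [SetLike.mem_coe, R_zero] at hf
      obtain ⟨c, rfl⟩ := Submodule.mem_span_singleton.1 hf
      have : c = 0 := by
        have := mem_meanZero_iff.1 hf0
        rwa [map_smul, mean_one, smul_eq_mul, mul_one] at this
      rw [this, zero_smul]
      exact zero_mem _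
    · have key : R T α ≤ (haarSpan T α).topologicalClosure.comap (center p).toLinearMap := by
        rw [R_limit hlim]
        refine Submodule.topologicalClosure_minimal _ (iSup_le fun ⟨γ, hγ⟩ => ?_)
          ((Submodule.isClosed_topologicalClosure _).preimage (center p).continuous)
        have hS := (hT α hα hlim).1 γ hγ
        rintro _ ⟨g, hg, rfl⟩
        have hc : center p (T α γ g) = T α γ (center p g) := by
          rw [center_apply, center_apply, map_sub, map_smul, hS.map_const, mean_apply, mean_apply,
            hS.integral_eq]
        change center p (T α γ g) ∈ (haarSpan T α).topologicalClosure
        rw [hc]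
        refine closure_haarSpan_le_comap (T := T) hS.continuous (fun lam I hlam hI => ?_)
          (ih γ hγ (lt_trans hγ hα) (center_mem_R0 hT (lt_trans hγ hα) hg))
        -- The tree of `0` is empty, so the index `γ = 0`, excluded from the limit constructor,
        -- requires nothing.
        have hγ1 : 1 ≤ γ := Order.one_le_iff_pos.2 (pos_iff_ne_zero.2 fun h => by
          subst h; exact not_inTree_zero hlam)
        refine Submodule.subset_span ⟨(Entry.ord α :: lam, I),
          ⟨InTree.limit α γ lam hlim hγ1 hγ hlam, ?_⟩, ?_⟩
        · rwa [kappaSeq_cons _ hlam.ne_nil]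
        · simp only [haarSeq, hlam.opSeq_limit, LinearMap.comp_apply]
      rintro f ⟨hf, hf0⟩
      rw [← center_of_mem hf0]
      exact key hf
  · have hβα : β < α := by
      conv_rhs => rw [hαβ]
      exact lt_add_of_pos_right β (by exact_mod_cast Nat.pos_of_ne_zero hκ)
    have hβω := hβα.trans hα
    -- Each generator `T_J f` splits into a multiple of `χ_J` and a copy of the centred `f`, to
    -- which the induction hypothesis at `β` applies.
    have key : R T α ≤ Submodule.span ℝ (Dyadic.char p '' {I : Dyadic | I.level = kappa α}) ⊔
        (haarSpan T α).topologicalClosure := by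
      rw [congrArg (R T) hαβ]
      refine R_add_nat_le β _ fun J hJ f hf => ?_
      rw [J.T_eq_center_add]
      refine Submodule.add_mem_sup (Submodule.smul_mem _ _ (Submodule.subset_span ⟨J, hJ, rfl⟩)) ?_
      refine closure_haarSpan_le_comap (T := T) (J.continuous_T hp) (fun lam I hlam hI => ?_)
        (ih β hβα hβω (center_mem_R0 hT hβω hf))
      refine Submodule.subset_span ⟨(Entry.ord α :: Entry.int J :: lam, I),
        ⟨InTree.branch α β J lam hκ hαβ hJ hlam, ?_⟩, ?_⟩
      · rwa [kappaSeq_cons _ (by simp), kappaSeq_cons _ hlam.ne_nil]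
      · simp only [haarSeq, opSeq_branch, LinearMap.comp_apply]
    rintro f ⟨hf, hf0⟩
    obtain ⟨c, hc, w, hw, rfl⟩ := Submodule.mem_sup.1 (key hf)
    -- The part `w` has mean zero, hence so has the step function `c`, which is therefore a
    -- combination of Haar functions of the head.
    have hw0 : w ∈ meanZero p := (closure_haarSpan_le hp hT hα hw).2
    have hc0 : c ∈ meanZero p := by
      have := sub_mem hf0 hw0
      rwa [add_sub_cancel_right] at this
    refine add_mem (Submodule.le_topologicalClosure _ ?_) hw
    have : c ∈ dyadicMeanZero p (kappa α) := ⟨hc, hc0⟩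
    rw [dyadicMeanZero_eq_span] at this
    refine Submodule.span_le.2 ?_ this
    rintro _ ⟨I, hI, rfl⟩
    exact Submodule.subset_span ⟨([Entry.ord α], I), ⟨InTree.head α hκ, hI⟩, rfl⟩

theorem R0_eq_closure_haarSpan (hp : p ≠ ∞) (hT : IsIndependentSystem T) {α : Ordinal.{0}}
    (hα : α < ω₁) : R0 T α = (haarSpan T α).topologicalClosure :=
  le_antisymm (R0_le_closure_haarSpan hp hT hα) (closure_haarSpan_le hp hT hα)

end

section

/-! ### The system `(h_I^λ)` as an unconditional martingale difference sequence -/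

variable {p : ℝ≥0∞}

theorem norm_rpow_eq_integral (hp1 : 1 < p) (hp : p ≠ ∞) (f : LpI p) :
    ‖f‖ ^ p.toReal = ∫ t, |f t| ^ p.toReal ∂unitMeasure := by
  have hp0 : 0 < p.toReal := ENNReal.toReal_pos (zero_lt_one.trans hp1).ne' hp
  have h0 : 0 ≤ ∫ t, |f t| ^ p.toReal ∂unitMeasure := integral_nonneg fun t => by positivity
  rw [Lp.norm_def, (Lp.memLp f).eLpNorm_eq_integral_rpow_norm (zero_lt_one.trans hp1).ne' hp]
  simp only [Real.norm_eq_abs]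
  rw [ENNReal.toReal_ofReal (by positivity), ← Real.rpow_mul h0, inv_mul_cancel₀ hp0.ne',
    Real.rpow_one]

theorem Dyadic.haar_ne_zero (I : Dyadic) : I.haar p ≠ 0 := by
  intro h
  have h1 : ∀ᵐ t ∂unitMeasure, t ∉ I.plus.toSet := by
    filter_upwards [I.coeFn_haar (p := p), Lp.coeFn_zero ℝ p unitMeasure] with t h1 h2 ht
    rw [h, h2, haarFun, Set.indicator_of_mem ht,
      Set.indicator_of_notMem (Set.disjoint_left.1 I.disjoint_plus_minus ht)] at h1
    simp at h1
  have h2 : unitMeasure I.plus.toSet = 0 := measure_eq_zero_iff_ae_notMem.2 h1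
  rw [unitMeasure_toSet, ENNReal.ofReal_eq_zero] at h2
  exact absurd h2 (not_le.2 (by positivity))

/-- The σ-algebra of the past is generated by the single vector `X`, so its sets are the preimages
`X⁻¹ A`, and the indicator of `A` is an admissible test function. -/
theorem condExp_eq_zero_of_orthogonal [Fact (1 ≤ p)] {n : ℕ} {f : Fin n → LpI p} {g : LpI p}
    (h : OrthogonalToFamily f g) :
    unitMeasure[(g : ℝ → ℝ) | ⨆ k : Fin n, MeasurableSpace.comap (f k : ℝ → ℝ) (borel ℝ)]
      =ᵐ[unitMeasure] 0 := by
  set X : ℝ → Fin n → ℝ := fun t k => f k t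
  have hX : Measurable X := measurable_coe_pi f
  have hm : ⨆ k : Fin n, MeasurableSpace.comap (f k : ℝ → ℝ) (borel ℝ) =
      MeasurableSpace.comap X MeasurableSpace.pi := by
    rw [MeasurableSpace.pi, MeasurableSpace.comap_iSup]
    simp_rw [MeasurableSpace.comap_comp]
    rfl
  rw [hm]
  have hg : Integrable (g : ℝ → ℝ) unitMeasure := (Lp.memLp g).integrable Fact.out
  refine (ae_eq_condExp_of_forall_setIntegral_eq hX.comap_le hg (fun s _ _ => integrableOn_zero)
    (fun s hs _ => ?_) aestronglyMeasurable_zero).symm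
  obtain ⟨A, hA, rfl⟩ := hs
  have := h (A.indicator fun _ => 1) (measurable_const.indicator hA) ⟨1, fun v => by
    by_cases hv : v ∈ A <;> simp [hv]⟩
  simp only [integral_zero]
  rw [← integral_indicator (hX hA), ← this]
  congr 1
  funext t
  by_cases ht : X t ∈ A
  · rw [Set.indicator_of_mem ht, one_mul, Set.indicator_of_mem (Set.mem_preimage.2 ht)]
  · rw [Set.indicator_of_notMem ht, zero_mul]
    exact (Set.indicator_of_notMem (show t ∉ X ⁻¹' A from ht) _).symm

/-- An `L_p`-version of Burkholder's inequality: martingale difference sequences of functions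
bounded by `1` are unconditional. -/
theorem exists_unconditionalConst [Fact (1 ≤ p)] (hp1 : 1 < p) (hp : p ≠ ∞) {N : ℕ∞}
    {e : ℕ → LpI p} (hb : ∀ n : ℕ, (n : ℕ∞) < N → ∀ᵐ t ∂unitMeasure, |e n t| ≤ 1)
    (ho : ∀ n : ℕ, (n : ℕ∞) < N → OrthogonalToFamily (fun i : Fin n => e i) (e n)) :
    ∃ C, UnconditionalConst N e C := by
  have hp1' : 1 < p.toReal := by
    rw [← ENNReal.toReal_one]; exact (ENNReal.toReal_lt_toReal ENNReal.one_ne_top hp).2 hp1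
  have hp0 : 0 < p.toReal := zero_lt_one.trans hp1'
  obtain ⟨C, hC0, hC⟩ := burkholder hp1'
  refine ⟨max 1 (C ^ (1 / p.toReal)), le_max_left _ _, fun k a b hab hbN => ?_⟩
  -- Burkholder's inequality above needs bounds at every point and for every index, so the terms are
  -- clipped and replaced by zero beyond `N`.
  let H : ℕ → ℝ → ℝ := fun n t => if (n : ℕ∞) < N then clip (e n t) else 0
  have hHm : ∀ n, Measurable (H n) := fun n => by
    by_cases hn : (n : ℕ∞) < N
    · simp only [H, hn, if_true]
      exact measurable_clip.comp (measurable_coe (e n))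
    · simp only [H, hn, if_false]
      exact measurable_const
  have hHb : ∀ n t, |H n t| ≤ 1 := fun n t => by
    by_cases hn : (n : ℕ∞) < N
    · simpa [H, hn] using abs_clip_le _
    · simp [H, hn]
  have hHe : ∀ᵐ t ∂unitMeasure, ∀ n : ℕ, (n : ℕ∞) < N → H n t = e n t := by
    rw [ae_all_iff]
    intro n
    by_cases hn : (n : ℕ∞) < N
    · filter_upwards [hb n hn] with t ht _
      simp [H, hn, clip_of_abs_le ht]
    · exact Eventually.of_forall fun t h => absurd h hn
  have hH : OrthogonalToPast unitMeasure k H := by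
    intro n _ ψ hψ hψb
    by_cases hn : (n : ℕ∞) < N
    · rw [← ho n hn ψ hψ hψb]
      refine integral_congr_ae ?_
      filter_upwards [hHe] with t ht
      rw [ht n hn, funext fun i : Fin n => ht i ((Nat.cast_lt.2 i.2).trans hn)]
    · simp [H, hn]
  have hsum : ∀ c : ℕ → ℝ, (∀ n : ℕ, N ≤ n → c n = 0) →
      ‖∑ n ∈ Finset.range k, c n • e n‖ ^ p.toReal =
        ∫ t, |∑ n ∈ Finset.range k, c n * H n t| ^ p.toReal ∂unitMeasure := by
    intro c hc
    rw [norm_rpow_eq_integral hp1 hp]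
    refine integral_congr_ae ?_
    have hsm : ∀ᵐ t ∂unitMeasure, ∀ n : ℕ, (c n • e n : LpI p) t = c n * e n t :=
      ae_all_iff.2 fun n => (Lp.coeFn_smul (c n) (e n)).mono fun t ht => by rw [ht]; rfl
    filter_upwards [hHe, hsm, Lp.coeFn_fun_finsetSum (Finset.range k) fun n => c n • e n]
      with t h1 h2 h3
    rw [h3]
    congr 2
    refine Finset.sum_congr rfl fun n _ => ?_
    rw [h2]
    rcases lt_or_ge (n : ℕ∞) N with hn | hn
    · rw [h1 n hn]
    · rw [hc n hn, zero_mul, zero_mul]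
  have haN : ∀ n : ℕ, N ≤ n → a n = 0 := fun n hn => by
    have := hab n; rw [hbN n hn, abs_zero] at this; exact abs_nonpos_iff.1 this
  -- The multipliers are the quotients; where `b n = 0` the quotient is `0` by convention and `a n =
  -- 0` by domination.
  have hθ : ∀ n, |a n / b n| ≤ 1 := fun n => by
    rw [abs_div]; exact div_le_one_of_le₀ (hab n) (abs_nonneg _)
  have hθb : ∀ n, a n / b n * b n = a n := fun n => by
    by_cases hbn : b n = 0
    · have := hab n
      rw [hbn, abs_zero] at this
      rw [hbn, mul_zero, abs_nonpos_iff.1 this]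
    · exact div_mul_cancel₀ _ hbn
  have key := hC unitMeasure hHm hHb hH b (fun n => a n / b n) hθ
  simp_rw [hθb] at key
  rw [← hsum a haN, ← hsum b hbN] at key
  have h1 : ‖∑ n ∈ Finset.range k, a n • e n‖ ≤
      C ^ (1 / p.toReal) * ‖∑ n ∈ Finset.range k, b n • e n‖ := by
    refine (Real.rpow_le_rpow_iff (norm_nonneg _) (by positivity) hp0).1 ?_
    rw [Real.mul_rpow (by positivity) (norm_nonneg _), ← Real.rpow_mul hC0.le,
      one_div_mul_cancel hp0.ne', Real.rpow_one]
    exact key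
  exact h1.trans (mul_le_mul_of_nonneg_right (le_max_right _ _) (norm_nonneg _))

theorem X_eq_span [Fact (1 ≤ p)] {T : Ordinal.{0} → Ordinal.{0} → LpI p →ₗ[ℝ] LpI p}
    (lam : List Entry) :
    X T lam = Submodule.span ℝ (haarSeq T lam '' {I : Dyadic | I.level < kappaSeq lam}) := by
  rw [X, dyadicMeanZero_eq_span, Submodule.map_span, Set.image_image]
  rfl

theorem finiteDimensional_X [Fact (1 ≤ p)]
    {T : Ordinal.{0} → Ordinal.{0} → LpI p →ₗ[ℝ] LpI p} (lam : List Entry) :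
    FiniteDimensional ℝ (X T lam) := by
  rw [X_eq_span]
  exact FiniteDimensional.span_of_finite ℝ ((Dyadic.finite_level_lt _).image _)

end

end BRS

end

/-! ### The main theorem. -/

theorem mainTheorem4 (p : ℝ≥0∞) [Fact (1 ≤ p)] (hp1 : 1 < p) (hp : p ≠ ∞)
    (T : Ordinal.{0} → Ordinal.{0} → BRS.LpI p →ₗ[ℝ] BRS.LpI p) (hT : BRS.IsIndependentSystem T)
    (α : Ordinal.{0}) (hα : α < ω₁)
    (N : ℕ∞) (lam : ℕ → List BRS.Entry) (I : ℕ → BRS.Dyadic)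
    (henum : BRS.Enumerates N (fun n => (lam n, I n)) (BRS.haarIndex α))
    (hcomp : BRS.Compatible N lam I) :
    BRS.IsMDS N (fun n => BRS.haarSeq T (lam n) (I n)) ∧
    BRS.closedSpan N (fun n => BRS.haarSeq T (lam n) (I n)) = BRS.R0 T α ∧
    BRS.IsUnconditionalBasis N (BRS.R0 T α) (fun n => BRS.haarSeq T (lam n) (I n)) ∧
    ∀ (M : ℕ∞) (nu : ℕ → List BRS.Entry), BRS.Enumerates M nu (BRS.tree α) →
      BRS.IsUnconditionalFDD M (BRS.R0 T α) (fun n => BRS.X T (nu n)) := by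
  have hmem : ∀ n : ℕ, (n : ℕ∞) < N → BRS.InTree α (lam n) ∧ (I n).level < BRS.kappaSeq (lam n) :=
    fun n hn => henum.mapsTo hn
  have horth : ∀ n : ℕ, (n : ℕ∞) < N → BRS.OrthogonalToFamily
      (fun i : Fin n => BRS.haarSeq T (lam i) (I i)) (BRS.haarSeq T (lam n) (I n)) := fun n hn =>
    (hmem n hn).1.orthogonalToFamily_haarSeq hT hα _ fun k => by
      have hk := hmem k ((Nat.cast_lt.2 k.2).trans hn)
      exact Or.inr ⟨_, _, hk.1, hk.2, hcomp k n k.2 hn, rfl⟩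
  have hspan : BRS.closedSpan N (fun n => BRS.haarSeq T (lam n) (I n)) = BRS.R0 T α := by
    rw [BRS.R0_eq_closure_haarSpan hp hT hα, BRS.closedSpan, BRS.haarSpan, ← henum.image_eq,
      Set.image_image]
  obtain ⟨C, hC⟩ := BRS.exists_unconditionalConst hp1 hp
    (fun n hn => (hmem n hn).1.abs_haarSeq_le hT hα (I n)) horth
  refine ⟨fun n _ hn => BRS.condExp_eq_zero_of_orthogonal (horth n hn), hspan, ?_,
    fun M nu hnu => ?_⟩
  · rw [← hspan]
    refine hC.isUnconditionalBasis fun n hn h => (I n).haar_ne_zero (p := p) ?_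
    exact (hmem n hn).1.opSeq_injective hp hT hα (h.trans (map_zero _).symm)
  · rw [← hspan]
    -- The blocks are the fibres of `lam`: the terms with `lam j = nu n` are the $h^\lambda_I$ with
    -- $\lambda$ = `nu n`, which span the corresponding $X_\lambda$.
    refine hC.isUnconditionalFDD (σ := lam) (ν := nu) hnu.injOn (fun j hj => ?_) (fun n hn => ?_)
      fun n _ => BRS.finiteDimensional_X _
    · obtain ⟨n, hn, h⟩ := hnu.surjOn (hmem j hj).1
      exact ⟨n, hn, h.symm⟩
    · rw [BRS.X_eq_span]
      congr 1
      ext f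
      constructor
      · rintro ⟨J, hJ, rfl⟩
        obtain ⟨j, hj, h⟩ := henum.surjOn (show (nu n, J) ∈ BRS.haarIndex α from
          ⟨hnu.mapsTo hn, hJ⟩)
        rw [Prod.mk.injEq] at h
        exact ⟨j, ⟨hj, h.1⟩, by simp only [h.1, h.2]⟩
      · rintro ⟨j, ⟨hj, h⟩, rfl⟩
        refine ⟨I j, ?_, by simp only [h]⟩
        have := (hmem j hj).2
        rwa [h] at this
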